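/- For $k,n\ge 0$ consider the complex Hilbert space $L^2(\mathbb R^k)$ with the translations $T_yf(x)=f(x-y)$, and let $\mathbb T^k=[-1/2,1/2)^k$ with Lebesgue measure $|\cdot|$. For $f\in L^2(\mathbb R^k)$ with Fourier transform $\hat f$ let $\Gamma f(x)=(\hat f(x+\ell))_{\ell\in\mathbb Z^k}\in\ell^2(\mathbb Z^k)$, defined for a.e. $x\in\mathbb T^k$. Let $\mathcal W\subseteq L^2(\mathbb R^k)$ be a finitely generated shift-invariant (FSI) subspace, i.e. the closed linear span of $\{T_\ell h:\ h\in A,\ \ell\in\mathbb Z^k\}$ for some finite set $A$; its length is the least possible cardinality of $A$. Let $J_{\mathcal W}$ be its measurable range function: the (a.e. unique) function from $\mathbb T^k$ to the closed subspaces of $\ell^2(\mathbb Z^k)$ such that $x\mapsto\langle P_{J_{\mathcal W}(x)}\xi,\eta\rangle$ is measurable for all $\xi,\eta\in\ell^2(\mathbb Z^k)$ and $\mathcal W=\{f\in L^2(\mathbb R^k):\Gamma f(x)\in J_{\mathcal W}(x)\text{ for a.e. }x\in\mathbb T^k\}$, where $P_V$ denotes the orthogonal projection onto $V$. Put $d(x)=\dim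 J_{\mathcal W}(x)$, which is a.e. at most the length of $\mathcal W$, and $$\kappa=\sum_{i=1}^{\mathrm{length}(\mathcal W)} i\cdot|\{x\in\mathbb T^k: d(x)=i\}|.$$ Let $\mathcal F=(f_1,\dots,f_n)\in\mathcal W^n$ be such that $E(\mathcal F)=\{T_\ell f_i\}_{\ell\in\mathbb Z^k,\,1\le i\le n}$ is a Bessel sequence, and let $S_{E(\mathcal F)}$ be its frame operator, $S_{E(\mathcal F)}f=\sum_{\ell,i}\langle f,T_\ell f_i\rangle T_\ell f_i$. For a convex function $\varphi:[0,\infty)\to[0,\infty)$ define the convex potential $$P_\varphi^{\mathcal W}(E(\mathcal F))=\int_{\mathbb T^k}\operatorname{tr}\big(\varphi(S_{\Gamma\mathcal F(x)})\,P_{J_{\mathcal W}(x)}\big)\,dx,$$ where $S_{\Gamma\mathcal F(x)}$ is the frame operator of the finite sequence $(\Gamma f_i(x))_{i=1}^n$ in $\ell^2(\mathbb Z^k)$ and $\varphi(S_{\Gamma\mathcal F(x)})$ is given by functional calculus. Assume that $\sum_{i=1}^n\|f_i\|^2=1$. Then $\kappa>0$, and: 1. For every convex $\varphi:[0,\infty)\to[0,\infty)$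 the integrand above is integrable on $\mathbb T^k$ and $P_\varphi^{\mathcal W}(E(\mathcal F))\ \ge\ \kappa\,\varphi(\kappa^{-1})$. 2. For every strictly convex $\varphi:[0,\infty)\to[0,\infty)$, equality $P_\varphi^{\mathcal W}(E(\mathcal F))=\kappa\,\varphi(\kappa^{-1})$ holds if and only if $S_{E(\mathcal F)}=\kappa^{-1}P_{\mathcal W}$. 3. $S_{E(\mathcal F)}=\kappa^{-1}P_{\mathcal W}$ holds if and only if $E(\mathcal F)$ is a tight frame for $\mathcal W$, i.e. there is $a>0$ with $\sum_{\ell,i}|\langle f,T_\ell f_i\rangle|^2=a\|f\|^2$ for all $f\in\mathcal W$. -/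

import Mathlib

open MeasureTheory
open scoped FourierTransform ENNReal

namespace FSI

noncomputable section

/-! ### Frames, Bessel sequences and frame operators in a Hilbert space -/

section Frames

variable {H : Type*} [NormedAddCommGroup H] [InnerProductSpace ℂ H]

/-- `g` is a `b`-Bessel sequence: `∑ᵢ |⟨f, gᵢ⟩|² ≤ b ‖f‖²` for every `f`. -/
def IsBesselWith {ι : Type*} (g : ι → H) (b : ℝ) : Prop :=
  ∀ f : H, Summable (fun i => ‖inner ℂ (g i) f‖ ^ 2) ∧
    ∑' i, ‖inner ℂ (g i) f‖ ^ 2 ≤ b * ‖f‖ ^ 2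

/-- `g` is a Bessel sequence. -/
def IsBessel {ι : Type*} (g : ι → H) : Prop := ∃ b : ℝ, 0 < b ∧ IsBesselWith g b

/-- `g` is a frame for the closed subspace `W` with frame bounds `0 < a ≤ b`. -/
def IsFrameWith {ι : Type*} (W : ClosedSubmodule ℂ H) (g : ι → H) (a b : ℝ) : Prop :=
  0 < a ∧ a ≤ b ∧ (∀ i, g i ∈ W) ∧
    ∀ f ∈ W, Summable (fun i => ‖inner ℂ (g i) f‖ ^ 2) ∧
      a * ‖f‖ ^ 2 ≤ ∑' i, ‖inner ℂ (g i) f‖ ^ 2 ∧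
      ∑' i, ‖inner ℂ (g i) f‖ ^ 2 ≤ b * ‖f‖ ^ 2

/-- `g` is a tight frame for the closed subspace `W`: both frame bounds can be chosen equal. -/
def IsTightFrame {ι : Type*} (W : ClosedSubmodule ℂ H) (g : ι → H) : Prop :=
  ∃ a : ℝ, IsFrameWith W g a a

/-- The analysis operator `T* : H → ℓ²(ι)`, `f ↦ (⟨f, gᵢ⟩)ᵢ`, of a Bessel sequence. -/
def analysisOperator {ι : Type*} (g : ι → H) (hg : IsBessel g) :
    H →L[ℂ] lp (fun _ : ι => ℂ) 2 :=
  LinearMap.mkContinuousOfExistsBound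
    { toFun := fun f => ⟨fun i => inner ℂ (g i) f, by
        obtain ⟨b, -, hb⟩ := hg
        refine memℓp_gen ?_
        simpa using (hb f).1⟩
      map_add' := fun f f' => by ext i; exact inner_add_right _ _ _
      map_smul' := fun c f => by ext i; exact inner_smul_right _ _ _ }
    (by
      obtain ⟨b, hb0, hb⟩ := hg
      refine ⟨Real.sqrt b, fun f => ?_⟩
      refine (sq_le_sq₀ (norm_nonneg _) (by positivity)).1 ?_
      rw [mul_pow, Real.sq_sqrt hb0.le]
      have h := lp.norm_rpow_eq_tsum (p := 2) (by simp)
        (⟨fun i => inner ℂ (g i) f, by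
          refine memℓp_gen ?_
          simpa using (hb f).1⟩ : lp (fun _ : ι => ℂ) 2)
      simp only [ENNReal.toReal_ofNat, Real.rpow_ofNat] at h
      exact h.le.trans (hb f).2)

/-- The synthesis operator `T : ℓ²(ι) → H`, `(aᵢ)ᵢ ↦ ∑ᵢ aᵢ gᵢ`, of a Bessel sequence, as the
adjoint of its analysis operator. -/
def synthesisOperator [CompleteSpace H] {ι : Type*} (g : ι → H) (hg : IsBessel g) :
    lp (fun _ : ι => ℂ) 2 →L[ℂ] H :=
  ContinuousLinearMap.adjoint (analysisOperator g hg)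

/-- The frame operator `S = T T*` of a Bessel sequence. -/
def frameOperator [CompleteSpace H] {ι : Type*} (g : ι → H) (hg : IsBessel g) : H →L[ℂ] H :=
  synthesisOperator g hg ∘L analysisOperator g hg

/-- A finite sequence is a Bessel sequence. -/
theorem isBessel_of_finite {n : ℕ} (g : Fin n → H) : IsBessel g := by
  refine ⟨1 + ∑ i, ‖g i‖ ^ 2, by positivity, fun f => ⟨(hasSum_fintype _).summable, ?_⟩⟩
  rw [tsum_fintype, add_mul, Finset.sum_mul]
  refine le_add_of_nonneg_of_le (by positivity) (Finset.sum_le_sum fun i _ => ?_)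
  rw [← mul_pow]
  exact pow_le_pow_left₀ (norm_nonneg _) (norm_inner_le_norm _ _) 2

/-- For a bounded operator `A` and a finite dimensional subspace `K`, the (real part of the)
trace `tr (A P_K)`, that is, the trace of the compression `P_K A|_K : K → K`. -/
def traceOn [CompleteSpace H] (K : ClosedSubmodule ℂ H) (A : H →L[ℂ] H) : ℝ :=
  (LinearMap.trace ℂ K.toSubmodule
    (K.toSubmodule.orthogonalProjectionOnto ∘L A ∘L K.toSubmodule.subtypeL).toLinearMap).re

/-- The convex potential `tr (φ(S_F) P_K)` of a finite sequence `F` in the finite dimensional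
subspace `K`; `φ(S_F)` is given by the functional calculus of the self-adjoint operator `S_F`
(which has a finite spectrum, contained in `[0, ∞)`, so that every `φ` is admissible). -/
def finitePotential [CompleteSpace H] (φ : ℝ → ℝ) (K : ClosedSubmodule ℂ H) {n : ℕ}
    (F : Fin n → H) : ℝ :=
  traceOn K (cfc φ (frameOperator F (isBessel_of_finite F)))

end Frames

/-! ### Shift-invariant subspaces of `L²(ℝᵏ)` and their fibers -/

/-- The space `ℝᵏ`. -/
abbrev Rk (k : ℕ) : Type := EuclideanSpace ℝ (Fin k)

/-- The complex Hilbert space `L²(ℝᵏ)`. -/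
abbrev L2 (k : ℕ) : Type := Lp (α := Rk k) ℂ 2

/-- The Hilbert space `ℓ²(ℤᵏ)`. -/
abbrev ell2 (k : ℕ) : Type := lp (fun _ : Fin k → ℤ => ℂ) 2

/-- A point of `ℤᵏ`, seen in `ℝᵏ`. -/
def intVec {k : ℕ} (l : Fin k → ℤ) : Rk k := WithLp.toLp 2 (fun j => (l j : ℝ))

/-- The translation `T_y f (x) = f (x - y)` on `L²(ℝᵏ)`. -/
def translation {k : ℕ} (y : Rk k) (f : L2 k) : L2 k :=
  Lp.compMeasurePreserving (fun x : Rk k => x - y) (measurePreserving_sub_right volume y) f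

/-- The family `E(F)` of integer translates of `F`. -/
def translates {k n : ℕ} (F : Fin n → L2 k) : (Fin k → ℤ) × Fin n → L2 k :=
  fun p => translation (intVec p.1) (F p.2)

/-- The shift-invariant subspace generated by `A`: the closed linear span of the integer
translates of the elements of `A`. -/
def siSpan {k : ℕ} (A : Set (L2 k)) : ClosedSubmodule ℂ (L2 k) :=
  (Submodule.span ℂ {g | ∃ f ∈ A, ∃ l : Fin k → ℤ, g = translation (intVec l) f}).closure

/-- `W` is a finitely generated shift-invariant subspace of `L²(ℝᵏ)`. -/
def IsFSI {k : ℕ} (W : ClosedSubmodule ℂ (L2 k)) : Prop :=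
  ∃ A : Finset (L2 k), W = siSpan (A : Set (L2 k))

/-- The length of an FSI subspace: the smallest cardinality of a finite generating set. -/
def length {k : ℕ} (W : ClosedSubmodule ℂ (L2 k)) : ℕ :=
  sInf {m | ∃ A : Finset (L2 k), A.card = m ∧ W = siSpan (A : Set (L2 k))}

/-- The torus `𝕋ᵏ = [-1/2, 1/2)ᵏ`. -/
def torus (k : ℕ) : Set (Rk k) := {x | ∀ j, x j ∈ Set.Ico (-1 / 2 : ℝ) (1 / 2)}

open Classical in
/-- The fiber `Γ f (x) = (f̂ (x + ℓ))_{ℓ ∈ ℤᵏ} ∈ ℓ²(ℤᵏ)`, where `f̂` is the Fourier transform on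
`L²(ℝᵏ)`. The sequence is square summable for almost every `x`; at the remaining points the fiber
is `0` by convention. -/
def fiber {k : ℕ} (f : L2 k) (x : Rk k) : ell2 k :=
  if h : Memℓp (fun l : Fin k → ℤ => (𝓕 f : L2 k) (x + intVec l)) 2 then ⟨_, h⟩ else 0

/-- `J` is a measurable range function associated with the shift-invariant subspace `W`. -/
structure IsRangeFunction {k : ℕ} (W : ClosedSubmodule ℂ (L2 k))
    (J : Rk k → ClosedSubmodule ℂ (ell2 k)) : Prop where
  measurable : ∀ ξ η : ell2 k,
    AEMeasurable (fun x => inner ℂ η ((J x).toSubmodule.starProjection ξ))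
      (volume.restrict (torus k))
  mem_iff : ∀ f : L2 k, f ∈ W ↔ ∀ᵐ x ∂(volume.restrict (torus k)), fiber f x ∈ J x

open Classical in
/-- The measurable range function `J_W` of the shift-invariant subspace `W`, which exists and is
determined by `W` up to a null set. -/
def rangeFunction {k : ℕ} (W : ClosedSubmodule ℂ (L2 k)) : Rk k → ClosedSubmodule ℂ (ell2 k) :=
  if h : ∃ J, IsRangeFunction W J then h.choose else fun _ => ⊥

/-- The dimension function `d(x) = dim J_W(x)` (almost everywhere finite for an FSI subspace). -/
def fiberDim {k : ℕ} (W : ClosedSubmodule ℂ (L2 k)) (x : Rk k) : ℕ :=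
  Module.finrank ℂ (rangeFunction W x).toSubmodule

/-- The constant `κ = ∑ᵢ i · |{x ∈ 𝕋ᵏ : d(x) = i}|`, for `1 ≤ i ≤ ` the length of `W`. -/
def kappa {k : ℕ} (W : ClosedSubmodule ℂ (L2 k)) : ℝ :=
  ∑ i ∈ Finset.Icc 1 (length W), (i : ℝ) * volume.real {x | x ∈ torus k ∧ fiberDim W x = i}

/-- The integrand `x ↦ P_φ^{J_W(x)}(Γ F(x))` of the convex potential. -/
def potentialDensity {k n : ℕ} (φ : ℝ → ℝ) (W : ClosedSubmodule ℂ (L2 k)) (F : Fin n → L2 k)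
    (x : Rk k) : ℝ :=
  finitePotential φ (rangeFunction W x) (fun i => fiber (F i) x)

/-- The convex potential `P_φ^W(E(F))` associated with `(φ, W)`. -/
def potential {k n : ℕ} (φ : ℝ → ℝ) (W : ClosedSubmodule ℂ (L2 k)) (F : Fin n → L2 k) : ℝ :=
  ∫ x in torus k, potentialDensity φ W F x

/-- `φ` restricts to a convex function `[0, ∞) → [0, ∞)`. -/
def IsConv (φ : ℝ → ℝ) : Prop := ConvexOn ℝ (Set.Ici 0) φ ∧ ∀ t, 0 ≤ t → 0 ≤ φ t

/-- `φ` restricts to a strictly convex function `[0, ∞) → [0, ∞)`. -/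
def IsStrictConv (φ : ℝ → ℝ) : Prop := StrictConvexOn ℝ (Set.Ici 0) φ ∧ ∀ t, 0 ≤ t → 0 ≤ φ t

end

end FSI

namespace FSI

/-! ### Functional calculus of finite frame operators -/

section FiniteFrames

variable {H : Type*} [NormedAddCommGroup H] [InnerProductSpace ℂ H]

/-! Fiberization turns the problem on `W` into a finite dimensional one at almost every point of the
torus. The map `f ↦ fiber f` is an isometry of L²(ℝᵏ) onto the square integrable fields in ℓ²(ℤᵏ)
(`norm_sq_eq_integral_fiber`, `exists_fiber_eq`), and a translation by an integer vector acts on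
each fiber as a scalar of modulus one. Hence the coefficients ⟨T_ℓ h, f⟩ are Fourier coefficients of
x ↦ ⟨Γh(x), Γf(x)⟩, and Parseval gives `integral_sum_inner_fiber_sq`: the quadratic form of the
frame operator is the integral of those of the fiber frame operators.

At almost every x the fiber operator restricted to J(x) has eigenvalues c₁, …, c_d ≥ 0, where d =
d(x). The potential density is ∑ φ(cᵢ), and ∑ cᵢ = ∑ ‖Γfᵢ(x)‖², whose integral is 1; moreover ∫ d =
κ. Thus κ⁻¹ is the mean of all eigenvalues, and the bound is Jensen's inequality: take a supporting
line of φ at κ⁻¹, apply it to each eigenvalue, then sum and integrate; the slope cancels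
(`integral_affineDensity`). If φ is strictly convex, equality forces every eigenvalue to be κ⁻¹, so
almost every fiber operator is κ⁻¹ times the projection onto J(x). By
`frameOperator_translates_eq_iff_ae` this is the same as the identity for the global frame operator.
A tight frame with bound a has fiber operators a·P_J(x), and integrating traces gives 1 = κa.

Behind this stand the existence and uniqueness of the range function (`isRangeFunction_spanFiber`,
`IsRangeFunction.ae_eq`) and the measurability of the density, where φ may be discontinuous at 0. -/

theorem aeval_apply_of_eigenvector {A : H →L[ℂ] H} {v : H} {c : ℝ} (hv : A v = (c : ℂ) • v)
    (p : Polynomial ℝ) : Polynomial.aeval A p v = ((p.eval c : ℝ) : ℂ) • v := by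
  induction p using Polynomial.induction_on' with
  | add p q hp hq => simp [hp, hq, add_smul]
  | monomial m r =>
    have hpow : (A ^ m) v = ((c : ℂ) ^ m) • v := by
      induction m with
      | zero => simp
      | succ m ih => rw [pow_succ', mul_apply_eq_comp, ih, map_smul, hv, smul_smul,
          pow_succ]
    rw [Polynomial.aeval_monomial, mul_apply_eq_comp, hpow, Polynomial.eval_monomial,
      Algebra.algebraMap_eq_smul_one, smul_apply,
      one_apply_eq_self, ← Complex.coe_smul, smul_smul]
    push_cast
    rfl

/-- On a finite spectrum φ coincides with a Lagrange interpolation polynomial, so no continuity of φ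
is needed. Adding c to the nodes avoids having to show that c lies in the spectrum. -/
theorem cfc_apply_of_eigenvector [CompleteSpace H] {A : H →L[ℂ] H} (hA : IsSelfAdjoint A)
    (hfin : (spectrum ℝ A).Finite) (φ : ℝ → ℝ) {v : H} {c : ℝ} (hv : A v = (c : ℂ) • v) :
    cfc φ A v = (φ c : ℂ) • v := by
  classical
  set s : Finset ℝ := insert c hfin.toFinset with hs
  set p : Polynomial ℝ := Lagrange.interpolate s id φ with hp
  have hev : ∀ t ∈ s, p.eval t = φ t := fun t ht =>
    Lagrange.eval_interpolate_at_node φ (v := id) (Set.injOn_id _) ht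
  have hcongr : cfc φ A = cfc (fun t => p.eval t) A :=
    cfc_congr fun t ht => (hev t (by simp [hs, ht])).symm
  rw [hcongr, cfc_polynomial p A hA, aeval_apply_of_eigenvector hv, hev c (by simp [hs])]

/-- The polynomial q·X annihilates A: the factor X sends every vector into K, and q kills the
eigenbasis of K. The spectrum then lies among its roots. -/
theorem finite_spectrum_of_orthonormalBasis {A : H →L[ℂ] H} {K : Submodule ℂ H}
    {d : ℕ} (b : OrthonormalBasis (Fin d) ℂ K) (c : Fin d → ℝ)
    (hb : ∀ i, A (b i) = (c i : ℂ) • (b i : H)) (hA : ∀ ξ, A ξ ∈ K) :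
    (spectrum ℝ A).Finite := by
  set q : Polynomial ℝ := ∏ i, (Polynomial.X - Polynomial.C (c i)) with hq
  have hzero : Polynomial.aeval A (q * Polynomial.X) = 0 := by
    ext ξ
    rw [map_mul, Polynomial.aeval_X, mul_apply_eq_comp,
      zero_apply]
    have hr := congrArg (K.subtype) (b.sum_repr ⟨A ξ, hA ξ⟩)
    simp only [Submodule.subtype_apply, Submodule.coe_sum, Submodule.coe_smul] at hr
    rw [← hr, map_sum]
    refine Finset.sum_eq_zero fun i _ => ?_
    rw [map_smul, aeval_apply_of_eigenvector (hb i)]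
    have : q.eval (c i) = 0 := by
      rw [hq, Polynomial.eval_prod]
      exact Finset.prod_eq_zero (Finset.mem_univ i) (by simp)
    simp [this]
  have hne : q * Polynomial.X ≠ 0 :=
    mul_ne_zero (Finset.prod_ne_zero_iff.2 fun i _ => Polynomial.X_sub_C_ne_zero _)
      Polynomial.X_ne_zero
  refine (Polynomial.finite_setOfPred_isRoot hne).subset fun t ht => ?_
  have h := spectrum.subset_polynomial_aeval A (q * Polynomial.X) ⟨t, ht, rfl⟩
  rw [hzero] at h
  rcases subsingleton_or_nontrivial (H →L[ℂ] H) with hs | hs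
  · exact absurd (isUnit_of_subsingleton _) (spectrum.mem_iff.1 h)
  · rw [spectrum.zero_eq] at h
    exact h

theorem analysisOperator_apply {ι : Type*} (g : ι → H) (hg : IsBessel g) (f : H) (i : ι) :
    analysisOperator g hg f i = inner ℂ (g i) f := rfl

variable [CompleteSpace H]

theorem inner_frameOperator {ι : Type*} (g : ι → H) (hg : IsBessel g) (f f' : H) :
    inner ℂ f (frameOperator g hg f') = ∑' i, inner ℂ f (g i) * inner ℂ (g i) f' := by
  rw [frameOperator, synthesisOperator, ContinuousLinearMap.comp_apply,
    ContinuousLinearMap.adjoint_inner_right, lp.inner_eq_tsum]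
  refine tsum_congr fun i => ?_
  rw [analysisOperator_apply, analysisOperator_apply, RCLike.inner_apply, mul_comm,
    inner_conj_symm]

theorem inner_frameOperator_self {ι : Type*} (g : ι → H) (hg : IsBessel g) (f : H) :
    inner ℂ f (frameOperator g hg f) = ((∑' i, ‖inner ℂ (g i) f‖ ^ 2 : ℝ) : ℂ) := by
  rw [inner_frameOperator, Complex.ofReal_tsum]
  refine tsum_congr fun i => ?_
  rw [← inner_conj_symm f (g i), RCLike.conj_mul]
  push_cast
  rfl

theorem isSelfAdjoint_frameOperator {ι : Type*} (g : ι → H) (hg : IsBessel g) :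
    IsSelfAdjoint (frameOperator g hg) := by
  rw [frameOperator, synthesisOperator, IsSelfAdjoint, ContinuousLinearMap.star_eq_adjoint,
    ContinuousLinearMap.adjoint_comp, ContinuousLinearMap.adjoint_adjoint]

theorem frameOperator_apply {n : ℕ} (F : Fin n → H) (hF : IsBessel F) (f : H) :
    frameOperator F hF f = ∑ i, inner ℂ (F i) f • F i := by
  refine ext_inner_left ℂ fun v => ?_
  rw [inner_frameOperator, tsum_fintype, inner_sum]
  exact Finset.sum_congr rfl fun i _ => by rw [inner_smul_right, mul_comm]

theorem frameOperator_apply_mem {n : ℕ} {F : Fin n → H} (hF : IsBessel F) {K : Submodule ℂ H}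
    (hFK : ∀ i, F i ∈ K) (f : H) : frameOperator F hF f ∈ K := by
  rw [frameOperator_apply]
  exact Submodule.sum_mem _ fun i _ => K.smul_mem _ (hFK i)

theorem continuous_frameOperator (n : ℕ) :
    Continuous fun F : Fin n → H => frameOperator F (isBessel_of_finite F) := by
  have : (fun F : Fin n → H => frameOperator F (isBessel_of_finite F)) =
      fun F => ∑ i, ContinuousLinearMap.smulRightL ℂ H H (innerSL ℂ (F i)) (F i) := by
    funext F
    ext f
    simp [frameOperator_apply]
  rw [this]
  refine continuous_finsetSum _ fun i _ => ?_
  exact ((ContinuousLinearMap.smulRightL ℂ H H).continuous.comp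
    ((innerSL ℂ).continuous.comp (continuous_apply i))).clm_apply (continuous_apply i)

/-- Used to get measurability in x of the fiberwise functional calculus, first for φ continuous on
the whole line. -/
theorem continuous_cfc_frameOperator (n : ℕ) {φ : ℝ → ℝ} (hφ : Continuous φ) :
    Continuous fun F : Fin n → H => cfc φ (frameOperator F (isBessel_of_finite F)) :=
  Continuous.cfc_of_mem_nhdsSet (s := Set.univ) φ Filter.univ_mem (continuous_frameOperator n)
    (fun F => isSelfAdjoint_frameOperator F _) hφ.continuousOn

theorem traceOn_eq_sum {K : ClosedSubmodule ℂ H} {d : ℕ}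
    (b : OrthonormalBasis (Fin d) ℂ K.toSubmodule) (A : H →L[ℂ] H) :
    traceOn K A = ∑ i, (inner ℂ (b i : H) (A (b i))).re := by
  rw [traceOn, LinearMap.trace_eq_sum_inner _ b, Complex.re_sum]
  refine Finset.sum_congr rfl fun i _ => ?_
  rw [Submodule.coe_inner]
  change (inner ℂ (b i : H) (K.toSubmodule.starProjection (A (b i)))).re = _
  rw [← Submodule.inner_starProjection_left_eq_right,
    Submodule.starProjection_eq_self_iff.2 (b i).2]

/-- Spectral decomposition of the frame operator of a finite sequence in a finite dimensional
subspace. -/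
theorem exists_eigenbasis_frameOperator {n : ℕ} (F : Fin n → H) (K : ClosedSubmodule ℂ H)
    [FiniteDimensional ℂ K.toSubmodule] (hFK : ∀ i, F i ∈ K) :
    ∃ (b : OrthonormalBasis (Fin (Module.finrank ℂ K.toSubmodule)) ℂ K.toSubmodule)
      (c : Fin (Module.finrank ℂ K.toSubmodule) → ℝ),
      (∀ i, 0 ≤ c i) ∧
      (∀ i, frameOperator F (isBessel_of_finite F) (b i) = (c i : ℂ) • (b i : H)) ∧
      (spectrum ℝ (frameOperator F (isBessel_of_finite F))).Finite ∧
      (∀ φ : ℝ → ℝ, finitePotential φ K F = ∑ i, φ (c i)) ∧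
      ∑ i, c i = ∑ i, ‖F i‖ ^ 2 := by
  set S := frameOperator F (isBessel_of_finite F) with hS
  have hSK : ∀ ξ, S ξ ∈ K.toSubmodule := frameOperator_apply_mem _ hFK
  have hsa : IsSelfAdjoint S := isSelfAdjoint_frameOperator _ _
  have hsym : (S : H →ₗ[ℂ] H).IsSymmetric := hsa.isSymmetric
  have hT : ((S : H →ₗ[ℂ] H).restrict (p := K.toSubmodule) (q := K.toSubmodule)
      fun x _ => hSK x).IsSymmetric := hsym.restrict_invariant fun x _ => hSK x
  set b := hT.eigenvectorBasis rfl with hb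
  set c := hT.eigenvalues rfl with hc
  have hbc : ∀ i, S (b i) = (c i : ℂ) • (b i : H) := fun i =>
    congrArg Subtype.val (hT.apply_eigenvectorBasis rfl i)
  have hfin := finite_spectrum_of_orthonormalBasis b c hbc hSK
  have hbb : ∀ i, inner ℂ (b i : H) (b i : H) = 1 := fun i => by
    rw [← Submodule.coe_inner, inner_self_eq_norm_sq_to_K, b.orthonormal.1 i]; simp
  -- This expression of the eigenvalues yields both their nonnegativity and, by Parseval in K, the
  -- trace identity.
  have hci : ∀ i, c i = ∑ j, ‖inner ℂ (F j) (b i : H)‖ ^ 2 := fun i => by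
    have h := inner_frameOperator_self F (isBessel_of_finite F) (b i : H)
    rw [← hS, hbc, inner_smul_right, hbb, mul_one, tsum_fintype] at h
    exact_mod_cast h
  refine ⟨b, c, fun i => ?_, hbc, hfin, fun φ => ?_, ?_⟩
  · rw [hci]; positivity
  · rw [finitePotential, traceOn_eq_sum b]
    refine Finset.sum_congr rfl fun i _ => ?_
    rw [← hS, cfc_apply_of_eigenvector hsa hfin φ (hbc i), inner_smul_right, hbb]
    simp
  · rw [Finset.sum_congr rfl fun i _ => hci i, Finset.sum_comm]
    refine Finset.sum_congr rfl fun j _ => ?_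
    have := b.sum_sq_norm_inner_left ⟨F j, hFK j⟩
    simpa [Submodule.coe_inner] using this

/-- Since every vector of F lies in K, the operator sees only the projection of its argument onto K;
it is enough to know it on a basis of K. -/
theorem frameOperator_eq_smul_starProjection {n : ℕ} {F : Fin n → H} (hF : IsBessel F)
    {K : ClosedSubmodule ℂ H} (hFK : ∀ i, F i ∈ K) {d : ℕ}
    (b : OrthonormalBasis (Fin d) ℂ K.toSubmodule) {t : ℂ}
    (hb : ∀ i, frameOperator F hF (b i) = t • (b i : H)) :
    frameOperator F hF = t • K.toSubmodule.starProjection := by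
  have hK : ∀ v ∈ K.toSubmodule, frameOperator F hF v = t • v := fun v hv => by
    have hr := congrArg (K.toSubmodule.subtype) (b.sum_repr ⟨v, hv⟩)
    simp only [Submodule.subtype_apply, Submodule.coe_sum, Submodule.coe_smul] at hr
    rw [← hr, map_sum, Finset.smul_sum]
    exact Finset.sum_congr rfl fun i _ => by rw [map_smul, hb, smul_comm]
  ext f
  rw [smul_apply, ← hK _ (K.toSubmodule.starProjection_apply_mem f),
    frameOperator_apply, frameOperator_apply]
  refine Finset.sum_congr rfl fun i _ => ?_
  rw [← Submodule.inner_starProjection_left_eq_right,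
    Submodule.starProjection_eq_self_iff.2 (hFK i)]

end FiniteFrames

noncomputable section

/-! ### Tiling of `ℝᵏ` by the translates of the torus -/

section Tiling

variable {k : ℕ}

/-- Lebesgue measure on the torus. -/
abbrev torusMeasure (k : ℕ) : Measure (Rk k) := volume.restrict (torus k)

theorem intVec_apply (l : Fin k → ℤ) (j : Fin k) : (intVec l) j = (l j : ℝ) := rfl

theorem measurableSet_torus (k : ℕ) : MeasurableSet (torus k) := by
  have : torus k = ⋂ j, (fun x : Rk k => x j) ⁻¹' Set.Ico (-1 / 2 : ℝ) (1 / 2) := by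
    ext x; simp [torus]
  rw [this]
  exact MeasurableSet.iInter fun j => measurableSet_Ico.preimage (by fun_prop)

/-- The index of the tile `torus k + intVec l` that contains a point. -/
def tileIndex (y : Rk k) : Fin k → ℤ := fun j => ⌊y j + 1 / 2⌋

theorem measurable_tileIndex : Measurable (tileIndex (k := k)) := by
  refine measurable_pi_lambda _ fun j => Int.measurable_floor.comp ?_
  fun_prop

theorem tileIndex_add_eq_iff (x : Rk k) (l : Fin k → ℤ) :
    tileIndex (x + intVec l) = l ↔ x ∈ torus k := by
  simp only [tileIndex, funext_iff, torus, Set.mem_ofPred_eq, PiLp.add_apply, intVec_apply,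
    Int.floor_eq_iff, Set.mem_Ico]
  refine forall_congr' fun j => ?_
  constructor <;> rintro ⟨h1, h2⟩ <;> constructor <;> linarith

theorem ae_forall_add_intVec {P : Rk k → Prop} (h : ∀ᵐ y, P y) :
    ∀ᵐ x ∂torusMeasure k, ∀ l, P (x + intVec l) :=
  ae_restrict_of_ae <| ae_all_iff.2 fun l =>
    (measurePreserving_add_right volume (intVec l)).quasiMeasurePreserving.ae h

theorem lintegral_eq_tsum_torus (f : Rk k → ℝ≥0∞) :
    ∫⁻ y, f y = ∑' l : Fin k → ℤ, ∫⁻ x in torus k, f (x + intVec l) := by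
  have hU : (⋃ l : Fin k → ℤ, tileIndex (k := k) ⁻¹' {l}) = Set.univ :=
    Set.eq_univ_of_forall fun y => Set.mem_iUnion.2 ⟨tileIndex y, rfl⟩
  rw [← setLIntegral_univ, ← hU, lintegral_iUnion
    (fun l => measurable_tileIndex (measurableSet_singleton l))
    (fun l l' hl => Set.disjoint_left.2 fun y hy hy' => hl (hy.symm.trans hy'))]
  refine tsum_congr fun l => ?_
  have hpre : (fun x : Rk k => x + intVec l) ⁻¹' (tileIndex ⁻¹' {l}) = torus k := by
    ext x; exact tileIndex_add_eq_iff x l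
  rw [← hpre]
  exact ((measurePreserving_add_right volume (intVec l)).setLIntegral_comp_preimage_emb
    (MeasurableEquiv.addRight (intVec l)).measurableEmbedding f _).symm

theorem lintegral_eq_lintegral_torus {f : Rk k → ℝ≥0∞} (hf : AEMeasurable f) :
    ∫⁻ y, f y = ∫⁻ x in torus k, ∑' l : Fin k → ℤ, f (x + intVec l) := by
  rw [lintegral_eq_tsum_torus, lintegral_tsum]
  exact fun l => (hf.comp_quasiMeasurePreserving
    (measurePreserving_add_right volume (intVec l)).quasiMeasurePreserving).restrict

end Tiling

/-! ### The fiber map -/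

section Fiber

variable {k : ℕ}

theorem enorm_sq_eq_tsum {ι : Type*} (v : lp (fun _ : ι => ℂ) 2) :
    ‖v‖ₑ ^ 2 = ∑' i, ‖v i‖ₑ ^ 2 := by
  have h := lp.hasSum_norm (p := 2) (by simp) v
  simp only [ENNReal.toReal_ofNat, Real.rpow_ofNat] at h
  have h2 := ENNReal.ofReal_tsum_of_nonneg (fun i => sq_nonneg ‖v i‖) h.summable
  rw [h.tsum_eq, ENNReal.ofReal_pow (norm_nonneg _), ofReal_norm] at h2
  rw [h2]
  exact tsum_congr fun i => by rw [ENNReal.ofReal_pow (norm_nonneg _), ofReal_norm]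

theorem memℓp_two_of_tsum_ne_top {ι : Type*} {v : ι → ℂ} (h : ∑' i, ‖v i‖ₑ ^ 2 ≠ ⊤) :
    Memℓp v 2 := by
  refine memℓp_gen ?_
  simpa using ENNReal.summable_toReal h

theorem eLpNorm_two_eq_lintegral {α E : Type*} [MeasurableSpace α] [NormedAddCommGroup E]
    {μ : Measure α} (f : α → E) : eLpNorm f 2 μ = (∫⁻ x, ‖f x‖ₑ ^ 2 ∂μ) ^ (1 / 2 : ℝ) := by
  rw [eLpNorm_eq_lintegral_rpow_enorm_toReal (by simp) (by simp)]
  simp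

/-- By Tonelli over the tiling, the integral of ∑ |f̂(x+ℓ)|² is ‖f̂‖² < ∞, so the default value 0 in
`fiber` is used only on a null set. -/
theorem ae_fiber_apply (f : L2 k) :
    ∀ᵐ x ∂torusMeasure k, ∀ l, fiber f x l = (𝓕 f : L2 k) (x + intVec l) := by
  set g : L2 k := 𝓕 f with hg
  have hm : AEMeasurable (fun y => ‖g y‖ₑ ^ 2) := by
    have := (Lp.aestronglyMeasurable g).enorm
    fun_prop
  have hfin : ∫⁻ x in torus k, ∑' l : Fin k → ℤ, ‖g (x + intVec l)‖ₑ ^ 2 ≠ ⊤ := by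
    rw [← lintegral_eq_lintegral_torus hm]
    have h := (Lp.memLp g).eLpNorm_ne_top
    rw [eLpNorm_two_eq_lintegral] at h
    intro h'
    simp [h'] at h
  have hm' : AEMeasurable (fun x => ∑' l : Fin k → ℤ, ‖g (x + intVec l)‖ₑ ^ 2)
      (torusMeasure k) := by
    refine AEMeasurable.tsum fun l => ?_
    exact (hm.comp_quasiMeasurePreserving
      (measurePreserving_add_right volume (intVec l)).quasiMeasurePreserving).restrict
  filter_upwards [ae_lt_top' hm' hfin] with x hx l
  have h := memℓp_two_of_tsum_ne_top hx.ne
  rw [fiber, dif_pos h]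

theorem hasSum_single_ell2 {ι : Type*} [DecidableEq ι] (v : lp (fun _ : ι => ℂ) 2) :
    HasSum (fun i => v i • lp.single (E := fun _ : ι => ℂ) 2 i (1 : ℂ)) v := by
  have h := lp.hasSum_single (p := 2) (by simp) v
  convert h using 2 with i
  rw [← lp.single_smul]
  simp

theorem aestronglyMeasurable_ell2 {α ι : Type*} [MeasurableSpace α] [Countable ι]
    {μ : Measure α} {u : α → lp (fun _ : ι => ℂ) 2}
    (hu : ∀ i, AEStronglyMeasurable (fun x => u x i) μ) : AEStronglyMeasurable u μ := by
  classical
  refine aestronglyMeasurable_of_tendsto_ae (Filter.atTop : Filter (Finset ι))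
    (f := fun s x => ∑ i ∈ s, u x i • lp.single (E := fun _ : ι => ℂ) 2 i (1 : ℂ))
    (fun s => ?_) (ae_of_all _ fun x => hasSum_single_ell2 (u x))
  exact Finset.aestronglyMeasurable_fun_sum _ fun i _ => (hu i).smul_const _

theorem aestronglyMeasurable_shift {E : Type*} [TopologicalSpace E] {g : Rk k → E}
    (hg : AEStronglyMeasurable g) (l : Fin k → ℤ) :
    AEStronglyMeasurable (fun x => g (x + intVec l)) (torusMeasure k) :=
  (hg.comp_quasiMeasurePreserving
    (measurePreserving_add_right volume (intVec l)).quasiMeasurePreserving).restrict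

theorem aestronglyMeasurable_fiber (f : L2 k) :
    AEStronglyMeasurable (fiber f) (torusMeasure k) := by
  refine aestronglyMeasurable_ell2 fun l => ?_
  refine (aestronglyMeasurable_shift (Lp.aestronglyMeasurable (𝓕 f : L2 k)) l).congr ?_
  filter_upwards [ae_fiber_apply f] with x hx using (hx l).symm

theorem eLpNorm_eq_of_ae_coord {g : Rk k → ℂ} (hg : AEStronglyMeasurable g) {u : Rk k → ell2 k}
    (hu : ∀ᵐ x ∂torusMeasure k, ∀ l, u x l = g (x + intVec l)) :
    eLpNorm u 2 (torusMeasure k) = eLpNorm g 2 volume := by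
  rw [eLpNorm_two_eq_lintegral, eLpNorm_two_eq_lintegral, lintegral_eq_lintegral_torus]
  · congr 1
    refine lintegral_congr_ae ?_
    filter_upwards [hu] with x hx
    rw [enorm_sq_eq_tsum]
    exact tsum_congr fun l => by rw [hx l]
  · have := hg.enorm
    fun_prop

theorem memLp_fiber (f : L2 k) : MemLp (fiber f) 2 (torusMeasure k) :=
  ⟨aestronglyMeasurable_fiber f, by
    rw [eLpNorm_eq_of_ae_coord (Lp.aestronglyMeasurable _) (ae_fiber_apply f)]
    exact (Lp.memLp _).eLpNorm_lt_top⟩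

theorem fiber_add (f g : L2 k) :
    ∀ᵐ x ∂torusMeasure k, fiber (f + g) x = fiber f x + fiber g x := by
  have h : (𝓕 (f + g) : L2 k) = 𝓕 f + 𝓕 g := FourierTransform.fourier_add f g
  filter_upwards [ae_fiber_apply f, ae_fiber_apply g, ae_fiber_apply (f + g),
    ae_forall_add_intVec (Lp.coeFn_add (𝓕 f : L2 k) (𝓕 g))] with x hf hg hfg hadd
  ext l
  rw [hfg, h, hadd, lp.coeFn_add, Pi.add_apply, Pi.add_apply, hf, hg]

theorem fiber_smul (c : ℂ) (f : L2 k) :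
    ∀ᵐ x ∂torusMeasure k, fiber (c • f) x = c • fiber f x := by
  have h : (𝓕 (c • f) : L2 k) = c • 𝓕 f := FourierTransform.fourier_smul c f
  filter_upwards [ae_fiber_apply f, ae_fiber_apply (c • f),
    ae_forall_add_intVec (Lp.coeFn_smul c (𝓕 f : L2 k))] with x hf hcf hsmul
  ext l
  rw [hcf, h, hsmul, lp.coeFn_smul, Pi.smul_apply, Pi.smul_apply, hf]

/-- The fiber map as a linear isometry `L²(ℝᵏ) → L²(𝕋ᵏ; ℓ²(ℤᵏ))`. -/
def fiberMap (k : ℕ) : L2 k →ₗᵢ[ℂ] Lp (ell2 k) 2 (torusMeasure k) where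
  toFun f := (memLp_fiber f).toLp _
  map_add' f g := by
    rw [← MemLp.toLp_add]
    exact MemLp.toLp_congr _ _ (fiber_add f g)
  map_smul' c f := by
    rw [RingHom.id_apply, ← MemLp.toLp_const_smul]
    exact MemLp.toLp_congr _ _ (fiber_smul c f)
  norm_map' f := by
    change ‖(memLp_fiber f).toLp _‖ = ‖f‖
    rw [Lp.norm_toLp, eLpNorm_eq_of_ae_coord (Lp.aestronglyMeasurable _) (ae_fiber_apply f),
      ← Lp.norm_def, Lp.norm_fourier_eq]

theorem coeFn_fiberMap (f : L2 k) : fiberMap k f =ᵐ[torusMeasure k] fiber f :=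
  (memLp_fiber f).coeFn_toLp

theorem fiber_sub (f g : L2 k) :
    ∀ᵐ x ∂torusMeasure k, fiber (f - g) x = fiber f x - fiber g x := by
  filter_upwards [coeFn_fiberMap (f - g), coeFn_fiberMap f, coeFn_fiberMap g,
    Lp.coeFn_sub (fiberMap k f) (fiberMap k g)] with x h1 h2 h3 h4
  rw [← h1, map_sub, h4, Pi.sub_apply, h2, h3]

theorem integrable_inner_fiber (f g : L2 k) :
    Integrable (fun x => inner ℂ (fiber f x) (fiber g x)) (torusMeasure k) := by
  refine (L2.integrable_inner (𝕜 := ℂ) (fiberMap k f) (fiberMap k g)).congr ?_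
  filter_upwards [coeFn_fiberMap f, coeFn_fiberMap g] with x h1 h2
  rw [h1, h2]

theorem inner_eq_integral_fiber (f g : L2 k) :
    inner ℂ f g = ∫ x in torus k, inner ℂ (fiber f x) (fiber g x) := by
  rw [← (fiberMap k).inner_map_map, L2.inner_def]
  refine integral_congr_ae ?_
  filter_upwards [coeFn_fiberMap f, coeFn_fiberMap g] with x h1 h2
  rw [h1, h2]

theorem integrable_norm_sq_fiber (f : L2 k) :
    Integrable (fun x => ‖fiber f x‖ ^ 2) (torusMeasure k) :=
  (memLp_fiber f).integrable_norm_pow (by simp)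

theorem norm_sq_eq_integral_fiber (f : L2 k) :
    ‖f‖ ^ 2 = ∫ x in torus k, ‖fiber f x‖ ^ 2 := by
  have h := inner_eq_integral_fiber f f
  simp only [inner_self_eq_norm_sq_to_K] at h
  have h2 : (∫ x in torus k, ((‖fiber f x‖ : ℂ)) ^ 2) =
      ((∫ x in torus k, ‖fiber f x‖ ^ 2 : ℝ) : ℂ) := by
    rw [← integral_complex_ofReal]
    simp
  have h3 : ((‖f‖ : ℂ)) ^ 2 = ((∫ x in torus k, ‖fiber f x‖ ^ 2 : ℝ) : ℂ) := h.trans h2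
  exact_mod_cast h3

/-- Every square integrable field of vectors in `ℓ²(ℤᵏ)` is the field of fibers of a function. -/
theorem exists_fiber_eq {u : Rk k → ell2 k} (hu : MemLp u 2 (torusMeasure k)) :
    ∃ f : L2 k, fiber f =ᵐ[torusMeasure k] u := by
  obtain ⟨v, hv, huv⟩ := hu.1
  -- Glue the coordinates: on the tile with index ℓ put the ℓ-th coordinate of the field, translated
  -- there. The required function is the inverse Fourier transform of g.
  set g : Rk k → ℂ := fun y => v (y - intVec (tileIndex y)) (tileIndex y) with hgdef
  have hg : Measurable g := by
    have h1 : Measurable (fun p : (Fin k → ℤ) × Rk k => v (p.2 - intVec p.1) p.1) := by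
      refine measurable_from_prod_countable_right fun l => ?_
      have hc : Continuous fun w : ell2 k => w l :=
        (lp.evalCLM (𝕜 := ℂ) (E := fun _ : Fin k → ℤ => ℂ) (p := 2) l).continuous
      have hs : Measurable fun y : Rk k => y - intVec l := measurable_id.sub_const _
      exact (hc.comp_stronglyMeasurable hv).measurable.comp hs
    exact h1.comp (measurable_tileIndex.prodMk measurable_id)
  have hgv : ∀ x ∈ torus k, ∀ l, v x l = g (x + intVec l) := fun x hx l => by
    simp only [hgdef, (tileIndex_add_eq_iff x l).2 hx, add_sub_cancel_right]
  have hcoord : ∀ᵐ x ∂torusMeasure k, ∀ l, v x l = g (x + intVec l) := by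
    filter_upwards [ae_restrict_mem (measurableSet_torus k)] with x hx using hgv x hx
  have hgL : MemLp g 2 volume := ⟨hg.aestronglyMeasurable, by
    rw [← eLpNorm_eq_of_ae_coord hg.aestronglyMeasurable hcoord, ← eLpNorm_congr_ae huv]
    exact hu.eLpNorm_lt_top⟩
  refine ⟨𝓕⁻ (hgL.toLp g), ?_⟩
  have hF : (𝓕 (𝓕⁻ (hgL.toLp g) : L2 k) : L2 k) = hgL.toLp g :=
    FourierTransform.fourier_fourierInv_eq _
  filter_upwards [ae_fiber_apply (𝓕⁻ (hgL.toLp g) : L2 k), hcoord, huv,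
    ae_forall_add_intVec hgL.coeFn_toLp] with x h1 h2 h3 h4
  ext l
  rw [h1, hF, h4, h3, h2]

end Fiber

/-! ### Fibers of translates -/

section Translation

variable {k : ℕ}

/-- The character `x ↦ exp (-2πi ⟨y, x⟩)`. -/
def shiftChar (y x : Rk k) : ℂ := (Real.fourierChar (-(inner ℝ y x)) : Circle)

theorem norm_shiftChar (y x : Rk k) : ‖shiftChar y x‖ = 1 := Circle.norm_coe _

theorem continuous_shiftChar (y : Rk k) : Continuous (shiftChar y) := by
  unfold shiftChar
  exact continuous_subtype_val.comp (Real.continuous_fourierChar.comp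
    ((continuous_const.inner continuous_id).neg))

/-- The inner product of two integer vectors is an integer. This periodicity lets a translation
multiply the whole fiber by one scalar. -/
theorem shiftChar_add_intVec (l m : Fin k → ℤ) (x : Rk k) :
    shiftChar (intVec l) (x + intVec m) = shiftChar (intVec l) x := by
  have h : inner ℝ (intVec l) (intVec m) = ((∑ j, m j * l j : ℤ) : ℝ) := by
    rw [PiLp.inner_apply]
    push_cast
    exact Finset.sum_congr rfl fun j _ => by simp [intVec_apply]
  have h1 : Real.fourierChar (-((∑ j, m j * l j : ℤ) : ℝ)) = 1 := by
    ext
    rw [Real.fourierChar_apply]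
    have := Complex.exp_int_mul_two_pi_mul_I (-(∑ j, m j * l j : ℤ))
    rw [Circle.coe_one, ← this]
    congr 1
    push_cast
    ring
  rw [shiftChar, shiftChar, inner_add_right, neg_add, AddChar.map_add_eq_mul, h, h1, mul_one]

theorem memLp_top_shiftChar (y : Rk k) : MemLp (shiftChar y) ∞ volume :=
  memLp_top_of_bound (continuous_shiftChar y).aestronglyMeasurable 1
    (ae_of_all _ fun x => (norm_shiftChar y x).le)

theorem coeFn_translation (y : Rk k) (f : L2 k) :
    translation y f =ᵐ[volume] fun x => f (x - y) :=
  Lp.coeFn_compMeasurePreserving f (measurePreserving_sub_right volume y)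

theorem continuous_translation (y : Rk k) : Continuous (translation y : L2 k → L2 k) :=
  (Lp.isometry_compMeasurePreserving (measurePreserving_sub_right volume y)).continuous

theorem fourier_comp_sub (f : Rk k → ℂ) (y w : Rk k) :
    𝓕 (fun x => f (x - y)) w = shiftChar y w * 𝓕 f w := by
  have h := congrFun (VectorFourier.fourierIntegral_comp_add_right Real.fourierChar
    (volume : Measure (Rk k)) (innerₗ (Rk k)) f (-y)) w
  have h' : 𝓕 (f ∘ fun v => v + -y) w =
      Real.fourierChar (innerₗ (Rk k) (-y) w) • 𝓕 f w := h
  simp only [Function.comp_def, ← sub_eq_add_neg] at h'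
  rw [h', Circle.smul_def, smul_eq_mul, shiftChar, innerₗ_apply_apply, inner_neg_left]

theorem translation_toLp (y : Rk k) (f : SchwartzMap (Rk k) ℂ) :
    translation y (f.toLp 2 volume) = (f.compSubConstCLM ℂ y).toLp 2 volume := by
  refine Lp.ext ?_
  filter_upwards [coeFn_translation y (f.toLp 2 volume),
    (f.compSubConstCLM ℂ y).coeFn_toLp 2 volume,
    (measurePreserving_sub_right volume y).quasiMeasurePreserving.ae (f.coeFn_toLp 2 volume)]
    with x h1 h2 h3
  rw [h1, h2, h3, SchwartzMap.compSubConstCLM_apply]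

/-- Both sides are continuous in f, so it is enough to check Schwartz functions, where the classical
formula applies. Multiplication by the character is made a bounded operator `M` through the Hölder
pairing of L^∞ with L². -/
theorem fourier_translation (y : Rk k) (f : L2 k) :
    (𝓕 (translation y f) : L2 k) =ᵐ[volume] fun x => shiftChar y x * (𝓕 f : L2 k) x := by
  set χ : Lp (α := Rk k) ℂ ∞ := (memLp_top_shiftChar y).toLp _ with hχ
  set M : L2 k →L[ℂ] L2 k := (ContinuousLinearMap.lsmul ℂ ℂ).holderL volume ∞ 2 2 χ with hM
  have hMf : ∀ g : L2 k, M g =ᵐ[volume] fun x => shiftChar y x * g x := fun g => by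
    have := ContinuousLinearMap.coeFn_holder (r := 2) (ContinuousLinearMap.lsmul ℂ ℂ (E := ℂ)) χ g
    filter_upwards [this, (memLp_top_shiftChar y).coeFn_toLp] with x h1 h2
    rw [← h2]
    exact h1
  suffices h : (𝓕 (translation y f) : L2 k) = M (𝓕 f) by rw [h]; exact hMf _
  have hd : DenseRange (SchwartzMap.toLpCLM ℝ ℂ 2 (volume : Measure (Rk k))) :=
    SchwartzMap.denseRange_toLpCLM ENNReal.ofNat_ne_top
  refine hd.induction_on (p := fun f : L2 k => (𝓕 (translation y f) : L2 k) = M (𝓕 f)) f ?_ ?_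
  · exact isClosed_eq ((Lp.fourierTransformₗᵢ (Rk k) ℂ).continuous.comp (continuous_translation y))
      (M.continuous.comp (Lp.fourierTransformₗᵢ (Rk k) ℂ).continuous)
  · intro f
    change (𝓕 (translation y (f.toLp 2 volume)) : L2 k) = M (𝓕 (f.toLp 2 volume : L2 k))
    rw [translation_toLp, SchwartzMap.toLp_fourier_eq, SchwartzMap.toLp_fourier_eq]
    refine Lp.ext ?_
    filter_upwards [hMf ((𝓕 f).toLp 2 volume), (𝓕 f).coeFn_toLp 2 volume,
      (𝓕 (f.compSubConstCLM ℂ y)).coeFn_toLp 2 volume] with x h1 h2 h3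
    rw [h1, h2, h3, SchwartzMap.fourier_coe, SchwartzMap.fourier_coe, ← fourier_comp_sub]
    rfl

theorem fiber_translation (l : Fin k → ℤ) (f : L2 k) :
    ∀ᵐ x ∂torusMeasure k, fiber (translation (intVec l) f) x =
      shiftChar (intVec l) x • fiber f x := by
  filter_upwards [ae_fiber_apply f, ae_fiber_apply (translation (intVec l) f),
    ae_forall_add_intVec (fourier_translation (intVec l) f)] with x h1 h2 h3
  ext m
  rw [h2, h3, lp.coeFn_smul, Pi.smul_apply, h1, shiftChar_add_intVec, smul_eq_mul]

end Translation

/-! ### Fourier series of integrable functions on the torus -/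

section FourierSeries

-- Haar measure of total mass one, for which the monomials `UnitAddTorus.mFourier` are orthonormal.
local instance : MeasureSpace UnitAddCircle := ⟨AddCircle.haarAddCircle⟩

local instance : Measure.IsAddHaarMeasure (volume : Measure UnitAddCircle) :=
  inferInstanceAs (Measure.IsAddHaarMeasure AddCircle.haarAddCircle)

local instance : IsProbabilityMeasure (volume : Measure UnitAddCircle) :=
  inferInstanceAs (IsProbabilityMeasure AddCircle.haarAddCircle)

variable {k : ℕ}

/-- Integration against G is a functional continuous for the sup norm that vanishes on the
characters, whose span is dense in the continuous functions. -/
theorem integral_continuous_mul_eq_zero {G : UnitAddTorus (Fin k) → ℂ} (hG : Integrable G)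
    (h : ∀ n, UnitAddTorus.mFourierCoeff G n = 0) (c : C(UnitAddTorus (Fin k), ℂ)) :
    ∫ t, c t * G t = 0 := by
  have hint : ∀ c : C(UnitAddTorus (Fin k), ℂ), Integrable fun t => c t * G t := fun c =>
    hG.bdd_mul (c := ‖c‖) c.continuous.aestronglyMeasurable (ae_of_all _ c.norm_coe_le_norm)
  let Λ : C(UnitAddTorus (Fin k), ℂ) →L[ℂ] ℂ := LinearMap.mkContinuous
    { toFun := fun c => ∫ t, c t * G t
      map_add' := fun c c' => by
        rw [← integral_add (hint c) (hint c')]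
        exact integral_congr_ae (ae_of_all _ fun t => by simp [add_mul])
      map_smul' := fun a c => by
        rw [RingHom.id_apply, ← integral_smul]
        exact integral_congr_ae (ae_of_all _ fun t => by simp [mul_assoc]) }
    (∫ t, ‖G t‖) (fun c => by
      change ‖∫ t, c t * G t‖ ≤ _
      rw [mul_comm, ← integral_const_mul]
      refine norm_integral_le_of_norm_le (hG.norm.const_mul _) (ae_of_all _ fun t => ?_)
      rw [norm_mul]
      exact mul_le_mul_of_nonneg_right (c.norm_coe_le_norm t) (norm_nonneg _))
  have hle : (Submodule.span ℂ (Set.range (UnitAddTorus.mFourier (d := Fin k)))).topologicalClosure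
      ≤ LinearMap.ker (Λ : C(UnitAddTorus (Fin k), ℂ) →ₗ[ℂ] ℂ) := by
    refine Submodule.topologicalClosure_minimal _ (Submodule.span_le.2 ?_) Λ.isClosed_ker
    rintro _ ⟨n, rfl⟩
    have := h (-n)
    rw [UnitAddTorus.mFourierCoeff, neg_neg] at this
    exact this
  rw [UnitAddTorus.span_mFourier_closure_eq_top] at hle
  exact hle (Submodule.mem_top (x := c))

/-- It suffices that G has zero integral over closed sets. Their indicators are limits of continuous
thickened indicators, with |G| as dominating function. -/
theorem ae_eq_zero_of_mFourierCoeff_eq_zero {G : UnitAddTorus (Fin k) → ℂ} (hG : Integrable G)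
    (h : ∀ n, UnitAddTorus.mFourierCoeff G n = 0) : G =ᵐ[volume] 0 := by
  refine ae_eq_zero_of_forall_setIntegral_isClosed_eq_zero hG fun s hs => ?_
  have hδ : ∀ n : ℕ, (0 : ℝ) < 1 / ((n : ℝ) + 1) := fun n => Nat.one_div_pos_of_nat
  have hlim := thickenedIndicator_tendsto_indicator_closure hδ
    tendsto_one_div_add_atTop_nhds_zero_nat s
  rw [hs.closure_eq, tendsto_pi_nhds] at hlim
  have hz : ∀ n : ℕ, ∫ t, ((thickenedIndicator (hδ n) s t : ℝ) : ℂ) * G t = 0 := fun n =>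
    integral_continuous_mul_eq_zero hG h
      ⟨fun t => ((thickenedIndicator (hδ n) s t : ℝ) : ℂ), by fun_prop⟩
  have hT : Filter.Tendsto
      (fun n : ℕ => ∫ t, ((thickenedIndicator (hδ n) s t : ℝ) : ℂ) * G t) Filter.atTop
      (nhds (∫ t, s.indicator G t)) := by
    refine tendsto_integral_of_dominated_convergence (fun t => ‖G t‖)
      (fun n => (Continuous.aestronglyMeasurable (by fun_prop)).mul hG.1) hG.norm
      (fun n => ae_of_all _ fun t => ?_) (ae_of_all _ fun t => ?_)
    · rw [norm_mul]
      refine mul_le_of_le_one_left (norm_nonneg _) ?_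
      rw [Complex.norm_real, Real.norm_of_nonneg NNReal.zero_le_coe]
      exact_mod_cast thickenedIndicator_le_one (hδ n) s t
    · have h1 := ((Complex.continuous_ofReal.comp NNReal.continuous_coe).tendsto _).comp (hlim t)
      have h2 := h1.mul_const (G t)
      refine h2.congr' (Filter.Eventually.of_forall fun n => rfl) |>.trans_eq ?_
      by_cases ht : t ∈ s <;> simp [ht]
  simp only [hz] at hT
  rw [← integral_indicator hs.measurableSet]
  exact tendsto_nhds_unique hT tendsto_const_nhds

/-- G is known only to be integrable, as is the inner product of two fiber fields. The L² function
with the same coefficients equals G by uniqueness, and Parseval applies to it. -/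
theorem integral_norm_sq_of_summable_mFourierCoeff {G : UnitAddTorus (Fin k) → ℂ}
    (hG : Integrable G) (h : Summable fun n => ‖UnitAddTorus.mFourierCoeff G n‖ ^ 2) :
    Integrable (fun t => ‖G t‖ ^ 2) ∧
      ∫ t, ‖G t‖ ^ 2 = ∑' n, ‖UnitAddTorus.mFourierCoeff G n‖ ^ 2 := by
  set c : lp (fun _ : Fin k → ℤ => ℂ) 2 :=
    ⟨UnitAddTorus.mFourierCoeff G, memℓp_gen (by simpa using h)⟩ with hc
  set f := UnitAddTorus.mFourierBasis.repr.symm c with hf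
  have hfc : ∀ n, UnitAddTorus.mFourierCoeff f n = UnitAddTorus.mFourierCoeff G n := fun n => by
    rw [← UnitAddTorus.mFourierBasis_repr, hf, LinearIsometryEquiv.apply_symm_apply]
  have hfL : MemLp f 2 volume := Lp.memLp f
  have hfi : Integrable f := hfL.integrable (by norm_num)
  have hae : G =ᵐ[volume] f := by
    refine (sub_ae_eq_zero _ _).1 (ae_eq_zero_of_mFourierCoeff_eq_zero (hG.sub hfi) fun n => ?_)
    have hb : ∀ g : UnitAddTorus (Fin k) → ℂ, Integrable g →
        Integrable fun t => UnitAddTorus.mFourier (-n) t • g t := fun g hg =>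
      hg.bdd_mul (c := ‖UnitAddTorus.mFourier (-n)‖)
        (UnitAddTorus.mFourier (-n)).continuous.aestronglyMeasurable
        (ae_of_all _ (UnitAddTorus.mFourier (-n)).norm_coe_le_norm)
    have := hfc n
    simp only [UnitAddTorus.mFourierCoeff] at this ⊢
    simp only [Pi.sub_apply, smul_sub]
    rw [integral_sub (hb G hG) (hb f hfi), this, sub_self]
  have hn : (fun t => ‖G t‖ ^ 2) =ᵐ[volume] fun t => ‖f t‖ ^ 2 := by
    filter_upwards [hae] with t ht using by rw [ht]
  refine ⟨(hfL.integrable_norm_pow (by simp)).congr hn.symm, ?_⟩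
  rw [integral_congr_ae hn, ← (UnitAddTorus.hasSum_sq_mFourierCoeff f).tsum_eq]
  exact tsum_congr fun n => by rw [hfc]

/-- The covering map `ℝᵏ → (ℝ/ℤ)ᵏ`. -/
def toUnitTorus (x : Rk k) : UnitAddTorus (Fin k) := fun i => (x i : UnitAddCircle)

/-- The section of the covering map with values in the torus `[-1/2, 1/2)ᵏ`. -/
def ofUnitTorus (t : UnitAddTorus (Fin k)) : Rk k :=
  WithLp.toLp 2 fun i => (AddCircle.equivIco 1 (-1 / 2 : ℝ) (t i) : ℝ)

theorem measurable_ofUnitTorus : Measurable (ofUnitTorus (k := k)) := by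
  refine (WithLp.measurable_toLp 2 (Fin k → ℝ)).comp (measurable_pi_lambda _ fun i => ?_)
  exact measurable_subtype_coe.comp
    ((AddCircle.measurableEquivIco 1 (-1 / 2 : ℝ)).measurable.comp (measurable_pi_apply i))

theorem ofUnitTorus_toUnitTorus {x : Rk k} (hx : x ∈ torus k) :
    ofUnitTorus (toUnitTorus x) = x := by
  ext i
  have hi : x i ∈ Set.Ico (-1 / 2 : ℝ) (-1 / 2 + 1) := by
    have := hx i
    norm_num at this ⊢
    exact this
  change (AddCircle.equivIco 1 (-1 / 2 : ℝ) (x i : UnitAddCircle) : ℝ) = x i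
  rw [AddCircle.equivIco_coe_eq hi]

theorem measurePreserving_toUnitTorus :
    MeasurePreserving (toUnitTorus (k := k)) (torusMeasure k) volume := by
  have h1 : MeasurePreserving (fun x : Fin k → ℝ => fun i => (x i : UnitAddCircle))
      (volume.restrict (Set.univ.pi fun _ => Set.Ico (-1 / 2 : ℝ) (1 / 2)))
      (volume : Measure (UnitAddTorus (Fin k))) := by
    rw [volume_pi, Measure.restrict_pi_pi]
    refine measurePreserving_pi _ _ fun i => ?_
    have h := AddCircle.measurePreserving_mk 1 (-1 / 2 : ℝ)
    rw [AddCircle.volume_eq_smul_haarAddCircle, ENNReal.ofReal_one, one_smul,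
      ← Measure.restrict_congr_set Ico_ae_eq_Ioc] at h
    norm_num at h ⊢
    exact h
  have h2 := (PiLp.volume_preserving_ofLp (Fin k)).restrict_preimage
    (MeasurableSet.univ_pi fun _ : Fin k => measurableSet_Ico (a := (-1 / 2 : ℝ)) (b := 1 / 2))
  have h3 : WithLp.ofLp ⁻¹' (Set.univ.pi fun _ => Set.Ico (-1 / 2 : ℝ) (1 / 2)) = torus k := by
    ext x; simp [torus]
  rw [h3] at h2
  exact h1.comp h2

theorem shiftChar_eq_mFourier (l : Fin k → ℤ) (x : Rk k) :
    shiftChar (intVec l) x = UnitAddTorus.mFourier (-l) (toUnitTorus x) := by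
  simp only [UnitAddTorus.mFourier, toUnitTorus, ContinuousMap.coe_mk, fourier_coe_apply]
  rw [← Complex.exp_sum, shiftChar, Real.fourierChar_apply, PiLp.inner_apply]
  congr 1
  push_cast
  rw [mul_neg, Finset.mul_sum, neg_mul, Finset.sum_mul, ← Finset.sum_neg_distrib]
  refine Finset.sum_congr rfl fun i _ => ?_
  simp [intVec_apply]
  ring

theorem comp_ofUnitTorus_toUnitTorus {E : Type*} (g : Rk k → E) :
    (fun x => (g ∘ ofUnitTorus) (toUnitTorus x)) =ᵐ[torusMeasure k] g := by
  filter_upwards [ae_restrict_mem (measurableSet_torus k)] with x hx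
  rw [Function.comp_apply, ofUnitTorus_toUnitTorus hx]

theorem measurePreserving_ofUnitTorus :
    MeasurePreserving (ofUnitTorus (k := k)) volume (torusMeasure k) := by
  refine ⟨measurable_ofUnitTorus, ?_⟩
  rw [← measurePreserving_toUnitTorus.map_eq,
    Measure.map_map measurable_ofUnitTorus measurePreserving_toUnitTorus.measurable]
  have : (ofUnitTorus ∘ toUnitTorus) =ᵐ[torusMeasure k] id := by
    filter_upwards [ae_restrict_mem (measurableSet_torus k)] with x hx using
      ofUnitTorus_toUnitTorus hx
  rw [Measure.map_congr this, Measure.map_id]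

instance isFiniteMeasure_torusMeasure : IsFiniteMeasure (torusMeasure k) := by
  rw [← measurePreserving_ofUnitTorus.map_eq]
  infer_instance

theorem integral_torus_eq {E : Type*} [NormedAddCommGroup E] [NormedSpace ℝ E] {g : Rk k → E}
    (hg : AEStronglyMeasurable g (torusMeasure k)) :
    ∫ x in torus k, g x = ∫ t, g (ofUnitTorus t) := by
  have h := measurePreserving_ofUnitTorus (k := k)
  change ∫ x, g x ∂torusMeasure k = _
  rw [← h.map_eq] at hg ⊢
  exact integral_map h.measurable.aemeasurable hg

theorem integral_shiftChar_mul {g : Rk k → ℂ} (hg : AEStronglyMeasurable g (torusMeasure k))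
    (l : Fin k → ℤ) :
    ∫ x in torus k, shiftChar (intVec l) x * g x =
      UnitAddTorus.mFourierCoeff (g ∘ ofUnitTorus) l := by
  refine (integral_torus_eq
    (((continuous_shiftChar (intVec l)).aestronglyMeasurable (μ := torusMeasure k)).mul hg)).trans ?_
  rw [UnitAddTorus.mFourierCoeff]
  refine integral_congr_ae ?_
  have h : ∀ᵐ t : UnitAddTorus (Fin k), toUnitTorus (ofUnitTorus t) = t := ae_of_all _ fun t => by
    funext i
    exact (AddCircle.equivIco 1 (-1 / 2 : ℝ)).symm_apply_apply (t i)
  filter_upwards [h] with t ht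
  rw [Pi.mul_apply, shiftChar_eq_mFourier, ht, Function.comp_apply, smul_eq_mul]

theorem integrable_comp_ofUnitTorus {E : Type*} [NormedAddCommGroup E] {g : Rk k → E}
    (hg : Integrable g (torusMeasure k)) : Integrable (g ∘ ofUnitTorus) :=
  (measurePreserving_ofUnitTorus.integrable_comp hg.1).2 hg

/-- An integrable function on the torus is determined by its Fourier coefficients. -/
theorem ae_eq_zero_of_integral_shiftChar_mul_eq_zero {g : Rk k → ℂ}
    (hg : Integrable g (torusMeasure k))
    (h : ∀ l : Fin k → ℤ, ∫ x in torus k, shiftChar (intVec l) x * g x = 0) :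
    g =ᵐ[torusMeasure k] 0 := by
  have h0 := ae_eq_zero_of_mFourierCoeff_eq_zero (integrable_comp_ofUnitTorus hg) fun l => by
    rw [← integral_shiftChar_mul hg.1, h]
  filter_upwards [measurePreserving_toUnitTorus.quasiMeasurePreserving.ae h0,
    comp_ofUnitTorus_toUnitTorus g] with x hx hgx
  rw [← hgx]
  exact hx

/-- Parseval's identity for integrable functions with square summable Fourier coefficients. -/
theorem integral_norm_sq_of_summable {g : Rk k → ℂ} (hg : Integrable g (torusMeasure k))
    (h : Summable fun l : Fin k → ℤ => ‖∫ x in torus k, shiftChar (intVec l) x * g x‖ ^ 2) :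
    Integrable (fun x => ‖g x‖ ^ 2) (torusMeasure k) ∧
      ∫ x in torus k, ‖g x‖ ^ 2 =
        ∑' l : Fin k → ℤ, ‖∫ x in torus k, shiftChar (intVec l) x * g x‖ ^ 2 := by
  simp only [integral_shiftChar_mul hg.1] at h ⊢
  obtain ⟨h1, h2⟩ :=
    integral_norm_sq_of_summable_mFourierCoeff (integrable_comp_ofUnitTorus hg) h
  rw [← h2]
  have hm : AEStronglyMeasurable (fun x => ‖g x‖ ^ 2) (torusMeasure k) := hg.1.norm.pow 2
  exact ⟨(measurePreserving_ofUnitTorus.integrable_comp hm).1 h1, integral_torus_eq hm⟩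

end FourierSeries

/-! ### Measurable fields of closed subspaces -/

section Fields

variable {k : ℕ}

/-- The standard basis vector of `ℓ²(ℤᵏ)`. -/
abbrev stdVec (l : Fin k → ℤ) : ell2 k := lp.single (E := fun _ : Fin k → ℤ => ℂ) 2 l (1 : ℂ)

theorem inner_stdVec_left (l : Fin k → ℤ) (v : ell2 k) : inner ℂ (stdVec l) v = v l := by
  rw [lp.inner_single_left]
  simp

theorem hasSum_stdVec (v : ell2 k) : HasSum (fun l => v l • stdVec l) v := hasSum_single_ell2 v

/-- Weak measurability of a field of closed subspaces of `ℓ²(ℤᵏ)`. -/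
def IsMeasurableField (J : Rk k → ClosedSubmodule ℂ (ell2 k)) : Prop :=
  ∀ ξ η : ell2 k, AEMeasurable (fun x => inner ℂ η ((J x).toSubmodule.starProjection ξ))
    (torusMeasure k)

/-- Self-adjointness moves the projection from the varying vector to the constant vectors `stdVec
l`, where weak measurability applies. -/
theorem IsMeasurableField.aestronglyMeasurable {J : Rk k → ClosedSubmodule ℂ (ell2 k)}
    (hJ : IsMeasurableField J) {u : Rk k → ell2 k}
    (hu : AEStronglyMeasurable u (torusMeasure k)) :
    AEStronglyMeasurable (fun x => (J x).toSubmodule.starProjection (u x)) (torusMeasure k) := by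
  refine aestronglyMeasurable_ell2 fun l => ?_
  have h1 : AEStronglyMeasurable (fun x => (J x).toSubmodule.starProjection (stdVec l))
      (torusMeasure k) := by
    refine aestronglyMeasurable_ell2 fun m => ?_
    simp only [← inner_stdVec_left]
    exact (hJ _ _).aestronglyMeasurable
  simp only [← inner_stdVec_left, ← Submodule.inner_starProjection_left_eq_right]
  exact h1.inner hu

theorem IsMeasurableField.memLp {J : Rk k → ClosedSubmodule ℂ (ell2 k)}
    (hJ : IsMeasurableField J) {u : Rk k → ell2 k} (hu : MemLp u 2 (torusMeasure k)) :
    MemLp (fun x => (J x).toSubmodule.starProjection (u x)) 2 (torusMeasure k) :=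
  hu.mono (hJ.aestronglyMeasurable hu.1) (ae_of_all _ fun _ =>
    Submodule.norm_starProjection_apply_le _ _)

/-- One Gram–Schmidt step, explicit enough to preserve measurability in x. If v lies in K, the
residual is 0 and division by zero does no harm. -/
theorem starProjection_closure_sup_span {H : Type*} [NormedAddCommGroup H]
    [InnerProductSpace ℂ H] [CompleteSpace H] (K : ClosedSubmodule ℂ H) (v w : H) :
    (K.toSubmodule ⊔ Submodule.span ℂ {v}).closure.toSubmodule.starProjection w =
      K.toSubmodule.starProjection w +
        (inner ℂ (v - K.toSubmodule.starProjection v) w /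
          ((‖v - K.toSubmodule.starProjection v‖ : ℂ) ^ 2)) •
          (v - K.toSubmodule.starProjection v) := by
  set P := K.toSubmodule.starProjection with hP
  set v' := v - P v with hv'
  have hPm : ∀ w, P w ∈ K.toSubmodule := K.toSubmodule.starProjection_apply_mem
  have hsup : K.toSubmodule ⊔ Submodule.span ℂ {v} ≤
      (K.toSubmodule ⊔ Submodule.span ℂ {v}).closure.toSubmodule :=
    Submodule.le_topologicalClosure _
  have hKle := le_sup_left.trans hsup
  have hvle : v ∈ (K.toSubmodule ⊔ Submodule.span ℂ {v}).closure.toSubmodule :=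
    (le_sup_right.trans hsup) (Submodule.mem_span_singleton_self v)
  have hv'K : ∀ u ∈ K.toSubmodule, inner ℂ u v' = 0 := fun u hu =>
    (Submodule.mem_orthogonal _ _).1 (K.toSubmodule.sub_starProjection_mem_orthogonal v) u hu
  have hw : ∀ u ∈ K.toSubmodule, inner ℂ u (w - P w) = 0 := fun u hu =>
    (Submodule.mem_orthogonal _ _).1 (K.toSubmodule.sub_starProjection_mem_orthogonal w) u hu
  refine Submodule.eq_starProjection_of_mem_orthogonal ?_ ?_
  · exact Submodule.add_mem _ (hKle (hPm w))
      (Submodule.smul_mem _ _ (Submodule.sub_mem _ hvle (hKle (hPm v))))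
  · change _ ∈ ((K.toSubmodule ⊔ Submodule.span ℂ {v}).topologicalClosure)ᗮ
    rw [Submodule.orthogonal_closure, ← Submodule.inf_orthogonal, Submodule.mem_inf]
    have hK : ∀ u ∈ K.toSubmodule, inner ℂ u (w - (P w + (inner ℂ v' w / (‖v'‖ : ℂ) ^ 2) • v')) = 0 :=
      fun u hu => by
        rw [← sub_sub, inner_sub_right, hw u hu, inner_smul_right, hv'K u hu, mul_zero, sub_zero]
    refine ⟨(Submodule.mem_orthogonal _ _).2 hK, ?_⟩
    rw [Submodule.mem_orthogonal_singleton_iff_inner_right]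
    have hvsplit : v = v' + P v := by rw [hv', sub_add_cancel]
    rw [hvsplit, inner_add_left, hK _ (hPm v), add_zero, ← sub_sub, inner_sub_right,
      inner_smul_right, inner_sub_right]
    have h0 : inner ℂ v' (P w) = 0 := by rw [← inner_conj_symm, hv'K _ (hPm w), map_zero]
    have h1 : inner ℂ v' v' = (‖v'‖ : ℂ) ^ 2 := inner_self_eq_norm_sq_to_K v'
    rw [h0, sub_zero, h1]
    by_cases hz : v' = 0
    · simp [hz]
    · rw [div_mul_cancel₀, sub_self]
      simpa using hz

theorem isMeasurableField_sup_span {J : Rk k → ClosedSubmodule ℂ (ell2 k)}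
    (hJ : IsMeasurableField J) {u : Rk k → ell2 k}
    (hu : AEStronglyMeasurable u (torusMeasure k)) :
    IsMeasurableField fun x => ((J x).toSubmodule ⊔ Submodule.span ℂ {u x}).closure := by
  intro ξ η
  simp only [starProjection_closure_sup_span]
  have hu' : AEStronglyMeasurable (fun x => u x - (J x).toSubmodule.starProjection (u x))
      (torusMeasure k) := hu.sub (hJ.aestronglyMeasurable hu)
  have hn : AEMeasurable (fun x => ((‖u x - (J x).toSubmodule.starProjection (u x)‖ : ℂ)) ^ 2)
      (torusMeasure k) :=
    (Complex.measurable_ofReal.comp_aemeasurable hu'.norm.aemeasurable).pow_const 2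
  have hc := ((hu'.inner (𝕜 := ℂ) (aestronglyMeasurable_const (b := ξ))).aemeasurable.div
    hn).aestronglyMeasurable
  exact ((aestronglyMeasurable_const (b := η)).inner (𝕜 := ℂ)
    ((hJ.aestronglyMeasurable (aestronglyMeasurable_const (b := ξ))).add
      (hc.smul hu'))).aemeasurable

/-- The field of subspaces spanned by the fibers of the elements of `A`. -/
def spanFiber (A : Set (L2 k)) (x : Rk k) : ClosedSubmodule ℂ (ell2 k) :=
  (Submodule.span ℂ ((fun h => fiber h x) '' A)).closure

theorem spanFiber_insert (h : L2 k) (A : Set (L2 k)) (x : Rk k) :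
    spanFiber (insert h A) x =
      ((spanFiber A x).toSubmodule ⊔ Submodule.span ℂ {fiber h x}).closure := by
  have hle : ∀ S : Submodule ℂ (ell2 k), S ≤ S.closure.toSubmodule :=
    Submodule.le_topologicalClosure
  refine le_antisymm ?_ ?_
  · rw [spanFiber, Submodule.closure_le, Set.image_insert_eq, Submodule.span_insert, sup_comm]
    exact (sup_le_sup_right (hle _) _).trans (hle _)
  · rw [Submodule.closure_le, sup_le_iff]
    refine ⟨?_, ?_⟩
    · rw [ClosedSubmodule.toSubmodule_le_toSubmodule, spanFiber, Submodule.closure_le]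
      exact (Submodule.span_mono (Set.image_mono (Set.subset_insert _ _))).trans (hle _)
    · refine (Submodule.span_mono ?_).trans (hle _)
      simp

theorem isMeasurableField_spanFiber (A : Finset (L2 k)) :
    IsMeasurableField (spanFiber (A : Set (L2 k))) := by
  classical
  induction A using Finset.induction_on with
  | empty =>
    intro ξ η
    have : ∀ x : Rk k, (spanFiber (∅ : Set (L2 k)) x).toSubmodule.starProjection ξ = 0 := fun x => by
      refine Submodule.eq_starProjection_of_mem_orthogonal (Submodule.zero_mem _) ?_
      change _ ∈ (Submodule.topologicalClosure _)ᗮ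
      rw [Submodule.orthogonal_closure]
      simp
    simp only [Finset.coe_empty, this, inner_zero_right]
    exact aemeasurable_const
  | insert h A _ ih =>
    have : spanFiber ((insert h A : Finset (L2 k)) : Set (L2 k)) =
        fun x => ((spanFiber (A : Set (L2 k)) x).toSubmodule ⊔
          Submodule.span ℂ {fiber h x}).closure := by
      funext x
      rw [Finset.coe_insert, spanFiber_insert]
    rw [this]
    exact isMeasurableField_sup_span ih (aestronglyMeasurable_fiber h)

theorem spanFiber_toSubmodule (A : Finset (L2 k)) (x : Rk k) :
    (spanFiber (A : Set (L2 k)) x).toSubmodule =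
      Submodule.span ℂ ((fun h => fiber h x) '' (A : Set (L2 k))) := by
  have : FiniteDimensional ℂ (Submodule.span ℂ ((fun h => fiber h x) '' (A : Set (L2 k)))) :=
    FiniteDimensional.span_of_finite ℂ (A.finite_toSet.image _)
  exact (Submodule.closed_of_finiteDimensional _).submodule_topologicalClosure_eq

theorem finiteDimensional_spanFiber (A : Finset (L2 k)) (x : Rk k) :
    FiniteDimensional ℂ (spanFiber (A : Set (L2 k)) x).toSubmodule := by
  rw [spanFiber_toSubmodule]
  exact FiniteDimensional.span_of_finite ℂ (A.finite_toSet.image _)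

theorem finrank_spanFiber_le (A : Finset (L2 k)) (x : Rk k) :
    Module.finrank ℂ (spanFiber (A : Set (L2 k)) x).toSubmodule ≤ A.card := by
  classical
  rw [spanFiber_toSubmodule, ← Finset.coe_image]
  exact (finrank_span_finset_le_card _).trans Finset.card_image_le

/-- The closed subspace of functions whose fibers lie in a measurable field of subspaces. -/
def fiberSubmodule (J : Rk k → ClosedSubmodule ℂ (ell2 k)) (hJ : IsMeasurableField J) :
    ClosedSubmodule ℂ (L2 k) where
  carrier := {f | ∀ᵐ x ∂torusMeasure k, fiber f x ∈ J x}
  add_mem' {f g} hf hg := by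
    filter_upwards [hf, hg, fiber_add f g] with x h1 h2 h3
    rw [h3]
    exact (J x).toSubmodule.add_mem h1 h2
  zero_mem' := by
    filter_upwards [fiber_smul (k := k) 0 0] with x h
    rw [zero_smul, zero_smul] at h
    rw [h]
    exact (J x).toSubmodule.zero_mem
  smul_mem' c f hf := by
    filter_upwards [hf, fiber_smul c f] with x h1 h2
    rw [h2]
    exact (J x).toSubmodule.smul_mem c h1
  isClosed' := by
    refine isClosed_of_closure_subset fun f hf => ?_
    set R : Rk k → ell2 k := fun x => fiber f x - (J x).toSubmodule.starProjection (fiber f x)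
    have hRm : MemLp R 2 (torusMeasure k) := (memLp_fiber f).sub (hJ.memLp (memLp_fiber f))
    -- The residual of f off the field does not change when an element g of the subspace is
    -- subtracted, so its norm is at most the distance from f to g; approximating f makes it vanish.
    have hle : ∀ g : L2 k, (∀ᵐ x ∂torusMeasure k, fiber g x ∈ J x) →
        ∫ x in torus k, ‖R x‖ ^ 2 ≤ ‖f - g‖ ^ 2 := fun g hg => by
      rw [norm_sq_eq_integral_fiber]
      refine integral_mono_ae (hRm.integrable_norm_pow (by simp)) (integrable_norm_sq_fiber _) ?_
      filter_upwards [hg, fiber_sub f g] with x hx hs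
      have h2 : R x = fiber (f - g) x - (J x).toSubmodule.starProjection (fiber (f - g) x) := by
        rw [hs, map_sub, Submodule.starProjection_eq_self_iff.2 hx]
        simp only [R]
        abel
      have h3 : ‖R x‖ ≤ ‖fiber (f - g) x‖ := by
        rw [h2, ← Submodule.starProjection_orthogonal_val]
        exact Submodule.norm_starProjection_apply_le _ _
      gcongr
    have h0 : ∫ x in torus k, ‖R x‖ ^ 2 = 0 := by
      refine le_antisymm ?_ (integral_nonneg fun x => sq_nonneg _)
      obtain ⟨g, hg, hgf⟩ := mem_closure_iff_seq_limit.1 hf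
      have hlim : Filter.Tendsto (fun n => ‖f - g n‖ ^ 2) Filter.atTop (nhds (‖f - f‖ ^ 2)) :=
        ((tendsto_const_nhds.sub hgf).norm).pow 2
      have := ge_of_tendsto' hlim fun n => hle (g n) (hg n)
      simpa using this
    have h4 := (integral_eq_zero_iff_of_nonneg (fun x => sq_nonneg ‖R x‖)
      (hRm.integrable_norm_pow (by simp))).1 h0
    change ∀ᵐ x ∂torusMeasure k, fiber f x ∈ J x
    filter_upwards [h4] with x hx
    have h5 : R x = 0 := by simpa using hx
    have h6 := sub_eq_zero.1 h5
    rw [h6]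
    exact (J x).toSubmodule.starProjection_apply_mem _

theorem mem_fiberSubmodule {J : Rk k → ClosedSubmodule ℂ (ell2 k)} (hJ : IsMeasurableField J)
    (f : L2 k) : f ∈ fiberSubmodule J hJ ↔ ∀ᵐ x ∂torusMeasure k, fiber f x ∈ J x := Iff.rfl

theorem mem_siSpan {A : Set (L2 k)} {f : L2 k} (hf : f ∈ A) (l : Fin k → ℤ) :
    translation (intVec l) f ∈ siSpan A :=
  Submodule.le_topologicalClosure _ (Submodule.subset_span ⟨f, hf, l, rfl⟩)

theorem fiber_mem_spanFiber {A : Set (L2 k)} {h : L2 k} (hh : h ∈ A) (x : Rk k) :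
    fiber h x ∈ spanFiber A x :=
  Submodule.le_topologicalClosure _ (Submodule.subset_span ⟨h, hh, rfl⟩)

theorem siSpan_le_fiberSubmodule {J : Rk k → ClosedSubmodule ℂ (ell2 k)}
    (hJ : IsMeasurableField J) {A : Set (L2 k)}
    (hA : ∀ h ∈ A, ∀ᵐ x ∂torusMeasure k, fiber h x ∈ J x) : siSpan A ≤ fiberSubmodule J hJ := by
  rw [siSpan, Submodule.closure_le, Submodule.span_le]
  rintro _ ⟨h, hh, l, rfl⟩
  change ∀ᵐ x ∂torusMeasure k, _
  filter_upwards [hA h hh, fiber_translation l h] with x h1 h2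
  rw [h2]
  exact (J x).toSubmodule.smul_mem _ h1

theorem shiftChar_intVec_neg (l : Fin k → ℤ) (x : Rk k) :
    shiftChar (intVec (-l)) x = starRingEnd ℂ (shiftChar (intVec l) x) := by
  have : intVec (-l) = -intVec l := by ext j; simp [intVec]
  rw [this, shiftChar, shiftChar, inner_neg_left, ← Circle.coe_inv_eq_conj, ← AddChar.map_neg_eq_inv]

theorem inner_translation_eq_integral (l : Fin k → ℤ) (h f : L2 k) :
    inner ℂ (translation (intVec l) h) f =
      ∫ x in torus k, shiftChar (intVec (-l)) x * inner ℂ (fiber h x) (fiber f x) := by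
  rw [inner_eq_integral_fiber]
  refine integral_congr_ae ?_
  filter_upwards [fiber_translation l h] with x hx
  rw [hx, inner_smul_left, shiftChar_intVec_neg]

/-- The residual g of f is orthogonal to all translates of each generator h, so ⟨Γh, Γg⟩ has zero
Fourier coefficients and vanishes almost everywhere. The fiber of g is thus in the span of the
fibers of A and orthogonal to it. -/
theorem fiberSubmodule_spanFiber_le (A : Finset (L2 k)) :
    fiberSubmodule _ (isMeasurableField_spanFiber A) ≤ siSpan (A : Set (L2 k)) := by
  intro f hf
  set W := siSpan (A : Set (L2 k)) with hW
  set g := f - W.toSubmodule.starProjection f with hg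
  have hPW : W.toSubmodule.starProjection f ∈ W := W.toSubmodule.starProjection_apply_mem f
  have hgJ : g ∈ fiberSubmodule _ (isMeasurableField_spanFiber A) :=
    (fiberSubmodule _ (isMeasurableField_spanFiber A)).toSubmodule.sub_mem hf
      (siSpan_le_fiberSubmodule (isMeasurableField_spanFiber A)
        (fun h hh => ae_of_all _ fun x => fiber_mem_spanFiber hh x) hPW)
  have horth : ∀ h ∈ A, ∀ᵐ x ∂torusMeasure k, inner ℂ (fiber h x) (fiber g x) = 0 := fun h hh => by
    refine ae_eq_zero_of_integral_shiftChar_mul_eq_zero (integrable_inner_fiber h g) fun l => ?_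
    have h1 := inner_translation_eq_integral (-l) h g
    rw [neg_neg] at h1
    rw [← h1]
    exact (Submodule.mem_orthogonal _ _).1 (W.toSubmodule.sub_starProjection_mem_orthogonal f) _
      (mem_siSpan hh _)
  have hz : ∀ᵐ x ∂torusMeasure k, fiber g x = 0 := by
    filter_upwards [(ae_ball_iff A.countable_toSet).2 horth, hgJ] with x hx hm
    have h1 : fiber g x ∈ ((spanFiber (A : Set (L2 k)) x).toSubmodule)ᗮ := by
      change _ ∈ (Submodule.topologicalClosure _)ᗮ
      rw [Submodule.orthogonal_closure, Submodule.mem_orthogonal]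
      intro u hu
      induction hu using Submodule.span_induction with
      | mem u hu =>
        obtain ⟨h, hh, rfl⟩ := hu
        exact hx h hh
      | zero => exact inner_zero_left _
      | add u v _ _ hu hv => rw [inner_add_left, hu, hv, add_zero]
      | smul c u _ hu => rw [inner_smul_left, hu, mul_zero]
    exact inner_self_eq_zero.1 ((Submodule.mem_orthogonal _ _).1 h1 _ hm)
  have hg0 : ‖g‖ ^ 2 = 0 := by
    rw [norm_sq_eq_integral_fiber, integral_congr_ae (g := fun _ => (0 : ℝ)), integral_zero]
    filter_upwards [hz] with x hx
    rw [hx]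
    simp
  have hg1 : g = 0 := by simpa using hg0
  rw [sub_eq_zero.1 hg1]
  exact hPW

/-! ### Existence, uniqueness and dimension of the range function. -/

theorem isRangeFunction_spanFiber (A : Finset (L2 k)) :
    IsRangeFunction (siSpan (A : Set (L2 k))) (spanFiber (A : Set (L2 k))) where
  measurable := isMeasurableField_spanFiber A
  mem_iff f := by
    rw [← mem_fiberSubmodule (isMeasurableField_spanFiber A)]
    exact ⟨fun h => siSpan_le_fiberSubmodule (isMeasurableField_spanFiber A)
      (fun h hh => ae_of_all _ fun x => fiber_mem_spanFiber hh x) h,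
      fun h => fiberSubmodule_spanFiber_le A h⟩

/-- The projections of the countably many `stdVec l` onto J(x) are square integrable fields, hence
fibers of elements of W, hence in J'(x) off one null set; their closed span is J(x). -/
theorem IsRangeFunction.ae_le {W : ClosedSubmodule ℂ (L2 k)}
    {J J' : Rk k → ClosedSubmodule ℂ (ell2 k)} (hJ : IsRangeFunction W J)
    (hJ' : IsRangeFunction W J') : ∀ᵐ x ∂torusMeasure k, J x ≤ J' x := by
  have hP : ∀ l : Fin k → ℤ, ∀ᵐ x ∂torusMeasure k,
      (J x).toSubmodule.starProjection (stdVec l) ∈ J' x := fun l => by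
    have hm : IsMeasurableField J := hJ.measurable
    obtain ⟨g, hg⟩ := exists_fiber_eq (hm.memLp (memLp_const (stdVec l)))
    have hgW : g ∈ W := (hJ.mem_iff g).2 (by
      filter_upwards [hg] with x hx
      rw [hx]
      exact (J x).toSubmodule.starProjection_apply_mem _)
    filter_upwards [hg, (hJ'.mem_iff g).1 hgW] with x h1 h2
    rwa [h1] at h2
  filter_upwards [ae_all_iff.2 hP] with x hx ξ hξ
  have h1 := (hasSum_stdVec ξ).mapL (J x).toSubmodule.starProjection
  rw [Submodule.starProjection_eq_self_iff.2 hξ] at h1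
  refine (J' x).isClosed.mem_of_tendsto h1 (Filter.Eventually.of_forall fun s => ?_)
  refine (J' x).toSubmodule.sum_mem fun l _ => ?_
  rw [map_smul]
  exact (J' x).toSubmodule.smul_mem _ (hx l)

theorem IsRangeFunction.ae_eq {W : ClosedSubmodule ℂ (L2 k)}
    {J J' : Rk k → ClosedSubmodule ℂ (ell2 k)} (hJ : IsRangeFunction W J)
    (hJ' : IsRangeFunction W J') : ∀ᵐ x ∂torusMeasure k, J x = J' x := by
  filter_upwards [hJ.ae_le hJ', hJ'.ae_le hJ] with x h1 h2 using le_antisymm h1 h2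

theorem isRangeFunction_rangeFunction {W : ClosedSubmodule ℂ (L2 k)} (hW : IsFSI W) :
    IsRangeFunction W (rangeFunction W) := by
  obtain ⟨A, rfl⟩ := hW
  have h : ∃ J, IsRangeFunction (siSpan (A : Set (L2 k))) J := ⟨_, isRangeFunction_spanFiber A⟩
  rw [rangeFunction, dif_pos h]
  exact h.choose_spec

theorem ae_finiteDimensional_rangeFunction {W : ClosedSubmodule ℂ (L2 k)} (hW : IsFSI W) :
    ∀ᵐ x ∂torusMeasure k, FiniteDimensional ℂ (rangeFunction W x).toSubmodule ∧
      fiberDim W x ≤ length W := by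
  have hne : {m | ∃ A : Finset (L2 k), A.card = m ∧ W = siSpan (A : Set (L2 k))}.Nonempty := by
    obtain ⟨A, hA⟩ := hW
    exact ⟨A.card, A, rfl, hA⟩
  obtain ⟨A, hcard, hA⟩ := Nat.sInf_mem hne
  have hJ := isRangeFunction_spanFiber A
  rw [← hA] at hJ
  filter_upwards [(isRangeFunction_rangeFunction hW).ae_eq hJ] with x hx
  rw [fiberDim, hx]
  exact ⟨finiteDimensional_spanFiber A x, (finrank_spanFiber_le A x).trans hcard.le⟩

/-- The fiberwise projection is the fiber field of some g in W, and f − g is orthogonal to W because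
it is so fiber by fiber. -/
theorem IsRangeFunction.fiber_starProjection {W : ClosedSubmodule ℂ (L2 k)}
    {J : Rk k → ClosedSubmodule ℂ (ell2 k)} (hJ : IsRangeFunction W J) (f : L2 k) :
    ∀ᵐ x ∂torusMeasure k, fiber (W.toSubmodule.starProjection f) x =
      (J x).toSubmodule.starProjection (fiber f x) := by
  have hm : IsMeasurableField J := hJ.measurable
  obtain ⟨g, hg⟩ := exists_fiber_eq (hm.memLp (memLp_fiber f))
  have hgW : g ∈ W := (hJ.mem_iff g).2 (by
    filter_upwards [hg] with x hx
    rw [hx]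
    exact (J x).toSubmodule.starProjection_apply_mem _)
  have horth : f - g ∈ W.toSubmoduleᗮ := by
    rw [Submodule.mem_orthogonal]
    intro h hh
    rw [inner_eq_integral_fiber, integral_congr_ae (g := fun _ => (0 : ℂ)), integral_zero]
    filter_upwards [hg, fiber_sub f g, (hJ.mem_iff h).1 hh] with x h1 h2 h3
    rw [h2, h1]
    exact (Submodule.mem_orthogonal _ _).1
      ((J x).toSubmodule.sub_starProjection_mem_orthogonal _) _ h3
  rw [Submodule.eq_starProjection_of_mem_orthogonal hgW horth]
  exact hg

end Fields

/-! ### Fiberization of the frame operator -/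

section Fiberization

variable {k n : ℕ}

/-- The frame operator of the fibers at a point. -/
abbrev fiberFrameOperator (F : Fin n → L2 k) (x : Rk k) : ell2 k →L[ℂ] ell2 k :=
  frameOperator (fun i => fiber (F i) x) (isBessel_of_finite _)

theorem inner_fiberFrameOperator_self (F : Fin n → L2 k) (x : Rk k) (ξ : ell2 k) :
    inner ℂ ξ (fiberFrameOperator F x ξ) = ((∑ i, ‖inner ℂ (fiber (F i) x) ξ‖ ^ 2 : ℝ) : ℂ) := by
  rw [inner_frameOperator_self, tsum_fintype]

/-- Parseval for ⟨Γh, Γf⟩, whose coefficient at −ℓ is ⟨T_ℓ h, f⟩; hence the reindexing by negation.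
-/
theorem integral_inner_fiber_sq {h f : L2 k}
    (hs : Summable fun l : Fin k → ℤ => ‖inner ℂ (translation (intVec l) h) f‖ ^ 2) :
    Integrable (fun x => ‖inner ℂ (fiber h x) (fiber f x)‖ ^ 2) (torusMeasure k) ∧
      ∫ x in torus k, ‖inner ℂ (fiber h x) (fiber f x)‖ ^ 2 =
        ∑' l : Fin k → ℤ, ‖inner ℂ (translation (intVec l) h) f‖ ^ 2 := by
  have he : ∀ l : Fin k → ℤ, ‖inner ℂ (translation (intVec (Equiv.neg _ l)) h) f‖ ^ 2 =
      ‖∫ x in torus k, shiftChar (intVec l) x * inner ℂ (fiber h x) (fiber f x)‖ ^ 2 := fun l => by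
    rw [inner_translation_eq_integral, Equiv.neg_apply, neg_neg]
  rw [← (Equiv.neg (Fin k → ℤ)).tsum_eq]
  rw [← (Equiv.neg (Fin k → ℤ)).summable_iff] at hs
  simp only [Function.comp_def, he] at hs ⊢
  exact integral_norm_sq_of_summable (integrable_inner_fiber h f) hs

theorem integral_sum_inner_fiber_sq {F : Fin n → L2 k} (hE : IsBessel (translates F)) (f : L2 k) :
    Integrable (fun x => ∑ i, ‖inner ℂ (fiber (F i) x) (fiber f x)‖ ^ 2) (torusMeasure k) ∧
      ∫ x in torus k, ∑ i, ‖inner ℂ (fiber (F i) x) (fiber f x)‖ ^ 2 =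
        ∑' p, ‖inner ℂ (translates F p) f‖ ^ 2 := by
  obtain ⟨b, -, hb⟩ := hE
  have hs := (hb f).1
  have hsi : ∀ i, Summable fun l : Fin k → ℤ =>
      ‖inner ℂ (translation (intVec l) (F i)) f‖ ^ 2 := fun i =>
    hs.comp_injective (i := fun l : Fin k → ℤ => (l, i)) fun l l' h => (Prod.mk.inj h).1
  refine ⟨integrable_finsetSum _ fun i _ => (integral_inner_fiber_sq (hsi i)).1, ?_⟩
  rw [integral_finsetSum _ fun i _ => (integral_inner_fiber_sq (hsi i)).1,
    ← (Equiv.prodComm (Fin n) (Fin k → ℤ)).tsum_eq]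
  refine Eq.trans ?_
    (Summable.tsum_prod ((Equiv.prodComm (Fin n) (Fin k → ℤ)).summable_iff.2 hs)).symm
  rw [tsum_fintype]
  exact Finset.sum_congr rfl fun i _ => (integral_inner_fiber_sq (hsi i)).2

theorem clm_ext_of_stdVec {A : ell2 k →L[ℂ] ell2 k}
    (h : ∀ l m : Fin k → ℤ, inner ℂ (A (stdVec m)) (stdVec l) = 0) : A = 0 := by
  have h0 : ∀ m, A (stdVec m) = 0 := fun m => by
    ext l
    rw [← inner_stdVec_left, ← inner_conj_symm, h, map_zero]
    rfl
  ext1 ξ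
  have h1 := (hasSum_stdVec ξ).mapL A
  simp only [map_smul, h0, smul_zero] at h1
  exact h1.unique hasSum_zero

theorem inner_starProjection_self {H : Type*} [NormedAddCommGroup H] [InnerProductSpace ℂ H]
    (K : Submodule ℂ H) [K.HasOrthogonalProjection] (v : H) :
    inner ℂ v (K.starProjection v) = ((‖K.starProjection v‖ ^ 2 : ℝ) : ℂ) := by
  have h := K.inner_starProjection_left_eq_right v (K.starProjection v)
  rw [Submodule.starProjection_eq_self_iff.2 (K.starProjection_apply_mem v)] at h
  rw [← h, inner_self_eq_norm_sq_to_K]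
  push_cast
  rfl

/-- Localization: testing the global identity on the function with fiber field 1_s·ξ gives equality
of the integrals over every measurable s. The exceptional null set depends on ξ. -/
theorem ae_quadratic_eq {F : Fin n → L2 k} (hE : IsBessel (translates F))
    {W : ClosedSubmodule ℂ (L2 k)} {J : Rk k → ClosedSubmodule ℂ (ell2 k)}
    (hJ : IsRangeFunction W J) {c : ℝ}
    (hS : ∀ f, ∑' p, ‖inner ℂ (translates F p) f‖ ^ 2 =
      c * ‖W.toSubmodule.starProjection f‖ ^ 2) (ξ : ell2 k) :
    ∀ᵐ x ∂torusMeasure k, ∑ i, ‖inner ℂ (fiber (F i) x) ξ‖ ^ 2 =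
      c * ‖(J x).toSubmodule.starProjection ξ‖ ^ 2 := by
  have hm : IsMeasurableField J := hJ.measurable
  set q : Rk k → ell2 k → ℝ := fun x η => ∑ i, ‖inner ℂ (fiber (F i) x) η‖ ^ 2 -
    c * ‖(J x).toSubmodule.starProjection η‖ ^ 2 with hq
  have hPint : ∀ f : L2 k, Integrable
      (fun x => c * ‖(J x).toSubmodule.starProjection (fiber f x)‖ ^ 2) (torusMeasure k) := fun f =>
    ((hm.memLp (memLp_fiber f)).integrable_norm_pow (by simp)).const_mul c
  have hqint : ∀ f : L2 k, Integrable (fun x => q x (fiber f x)) (torusMeasure k) ∧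
      ∫ x in torus k, q x (fiber f x) = 0 := fun f => by
    refine ⟨(integral_sum_inner_fiber_sq hE f).1.sub (hPint f), ?_⟩
    rw [hq]
    change ∫ x in torus k, (∑ i, ‖inner ℂ (fiber (F i) x) (fiber f x)‖ ^ 2 -
      c * ‖(J x).toSubmodule.starProjection (fiber f x)‖ ^ 2) = 0
    rw [integral_sub (integral_sum_inner_fiber_sq hE f).1 (hPint f),
      (integral_sum_inner_fiber_sq hE f).2, hS, integral_const_mul, norm_sq_eq_integral_fiber,
      sub_eq_zero]
    congr 1
    refine integral_congr_ae ?_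
    filter_upwards [hJ.fiber_starProjection f] with x hx
    rw [hx]
  have hind : ∀ s : Set (Rk k), MeasurableSet s →
      Integrable (s.indicator fun x => q x ξ) (torusMeasure k) ∧
      ∫ x in torus k, s.indicator (fun x => q x ξ) x = 0 := fun s hs => by
    obtain ⟨f, hf⟩ := exists_fiber_eq ((memLp_const (μ := torusMeasure k) (p := 2) ξ).indicator hs)
    have he : (fun x => q x (fiber f x)) =ᵐ[torusMeasure k] s.indicator fun x => q x ξ := by
      filter_upwards [hf] with x hx
      by_cases hxs : x ∈ s <;> simp [hx, hxs, hq]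
    exact ⟨(hqint f).1.congr he, (integral_congr_ae he).symm.trans (hqint f).2⟩
  have hint : Integrable (fun x => q x ξ) (torusMeasure k) := by
    have := (hind Set.univ MeasurableSet.univ).1
    rwa [Set.indicator_univ] at this
  have h0 := hint.ae_eq_zero_of_forall_setIntegral_eq_zero fun s hs _ => by
    rw [← integral_indicator hs]
    exact (hind s hs).2
  filter_upwards [h0] with x hx
  exact sub_eq_zero.1 hx

/-- An operator on a complex Hilbert space is determined by its quadratic form. -/
theorem frameOperator_translates_eq_iff_tsum {F : Fin n → L2 k} (hE : IsBessel (translates F))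
    (W : ClosedSubmodule ℂ (L2 k)) (c : ℝ) :
    frameOperator (translates F) hE = (c : ℂ) • W.toSubmodule.starProjection ↔
      ∀ f, ∑' p, ‖inner ℂ (translates F p) f‖ ^ 2 =
        c * ‖W.toSubmodule.starProjection f‖ ^ 2 := by
  have key : ∀ f, inner ℂ f (((c : ℂ) • W.toSubmodule.starProjection) f) =
      ((c * ‖W.toSubmodule.starProjection f‖ ^ 2 : ℝ) : ℂ) := fun f => by
    rw [smul_apply, inner_smul_right, inner_starProjection_self]
    push_cast
    rfl
  constructor
  · intro h f
    have h1 := inner_frameOperator_self (translates F) hE f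
    rw [h, key] at h1
    exact_mod_cast h1.symm
  · intro h
    refine ContinuousLinearMap.coe_injective ((ext_inner_map _ _).1 fun f => ?_)
    have h1 : inner ℂ f (frameOperator (translates F) hE f) =
        inner ℂ f (((c : ℂ) • W.toSubmodule.starProjection) f) := by
      rw [inner_frameOperator_self, key, h]
    rw [← inner_conj_symm, ← inner_conj_symm _ f]
    exact congrArg _ h1

/-- The frame operator of `E(F)` is a multiple of the projection onto `W` if and only if almost
all the frame operators of the fibers are the same multiple of the projections onto the range
function. -/
theorem frameOperator_translates_eq_iff_ae {F : Fin n → L2 k} (hE : IsBessel (translates F))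
    {W : ClosedSubmodule ℂ (L2 k)} {J : Rk k → ClosedSubmodule ℂ (ell2 k)}
    (hJ : IsRangeFunction W J) (c : ℝ) :
    frameOperator (translates F) hE = (c : ℂ) • W.toSubmodule.starProjection ↔
      ∀ᵐ x ∂torusMeasure k,
        fiberFrameOperator F x = (c : ℂ) • (J x).toSubmodule.starProjection := by
  rw [frameOperator_translates_eq_iff_tsum]
  constructor
  · intro h
    have hq := ae_quadratic_eq hE hJ h
    -- Only countably many null sets may be discarded, so the quadratic identity is used just for
    -- the vectors that polarization needs to recover all matrix entries.
    have hall : ∀ᵐ x ∂torusMeasure k, ∀ l m : Fin k → ℤ, ∀ z : Fin 4,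
        ∑ i, ‖inner ℂ (fiber (F i) x) (stdVec l + Complex.I ^ (z : ℕ) • stdVec m)‖ ^ 2 =
          c * ‖(J x).toSubmodule.starProjection
            (stdVec l + Complex.I ^ (z : ℕ) • stdVec m)‖ ^ 2 :=
      ae_all_iff.2 fun l => ae_all_iff.2 fun m => ae_all_iff.2 fun z => hq _
    filter_upwards [hall] with x hx
    set A : ell2 k →L[ℂ] ell2 k :=
      fiberFrameOperator F x - (c : ℂ) • (J x).toSubmodule.starProjection with hA
    have hA0 : ∀ l m : Fin k → ℤ, ∀ z : Fin 4,
        inner ℂ (A (stdVec l + Complex.I ^ (z : ℕ) • stdVec m))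
          (stdVec l + Complex.I ^ (z : ℕ) • stdVec m) = 0 := fun l m z => by
      rw [← inner_conj_symm, hA, sub_apply, inner_sub_right,
        inner_fiberFrameOperator_self, smul_apply, inner_smul_right, inner_starProjection_self, hx]
      push_cast
      rw [sub_self, map_zero]
    refine sub_eq_zero.1 (clm_ext_of_stdVec fun l m => ?_)
    have h0 := hA0 l m 0
    have h1 := hA0 l m 1
    have h2 := hA0 l m 2
    have h3 := hA0 l m 3
    simp only [Fin.val_zero, Fin.val_one, Fin.val_two, pow_zero, pow_one, one_smul,
      show ((3 : Fin 4) : ℕ) = 3 from rfl, Complex.I_sq, Complex.I_pow_three, neg_smul,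
      ← sub_eq_add_neg] at h0 h1 h2 h3
    have hp := inner_map_polarization (A : ell2 k →ₗ[ℂ] ell2 k) (stdVec l) (stdVec m)
    simp only [ContinuousLinearMap.coe_coe, h0, h1, h2, h3, mul_zero, sub_zero, add_zero,
      zero_div] at hp
    exact hp
  · intro h f
    rw [← (integral_sum_inner_fiber_sq hE f).2, norm_sq_eq_integral_fiber, ← integral_const_mul]
    refine integral_congr_ae ?_
    filter_upwards [h, hJ.fiber_starProjection f] with x hx hP
    have h1 := inner_fiberFrameOperator_self F x (fiber f x)
    rw [hx, smul_apply, inner_smul_right, inner_starProjection_self, ← hP] at h1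
    exact_mod_cast h1.symm

/-- The fibers of a Bessel system are essentially bounded. -/
theorem exists_ae_norm_sq_fiber_le {F : Fin n → L2 k} (hE : IsBessel (translates F)) :
    ∃ b : ℝ, 0 ≤ b ∧ ∀ᵐ x ∂torusMeasure k, ∀ i, ‖fiber (F i) x‖ ^ 2 ≤ b := by
  obtain ⟨b, hb0, hb⟩ := id hE
  refine ⟨b, hb0.le, ae_all_iff.2 fun i => ?_⟩
  have hint : Integrable (fun x => ‖inner ℂ (fiber (F i) x) (fiber (F i) x)‖ ^ 2)
      (torusMeasure k) := by
    refine (integral_inner_fiber_sq ?_).1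
    exact (hb (F i)).1.comp_injective (i := fun l : Fin k → ℤ => (l, i))
      fun l l' h => (Prod.mk.inj h).1
  -- The Bessel inequality tested on the field 1_s·Γ(F i) gives ∫_s ‖Γ(F i)‖⁴ ≤ b ∫_s ‖Γ(F i)‖² for
  -- every s, hence the pointwise bound.
  have hle := ae_le_of_forall_setIntegral_le hint ((integrable_norm_sq_fiber (F i)).const_mul b)
    fun s hs _ => by
      obtain ⟨f, hf⟩ := exists_fiber_eq ((memLp_fiber (F i)).indicator hs)
      have h1 := (hb f).2
      rw [← (integral_sum_inner_fiber_sq hE f).2, norm_sq_eq_integral_fiber,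
        ← integral_const_mul] at h1
      rw [← integral_indicator hs, ← integral_indicator hs]
      refine (integral_mono_ae (hint.indicator hs) (integral_sum_inner_fiber_sq hE f).1 ?_).trans
        (h1.trans_eq (integral_congr_ae ?_))
      · filter_upwards [hf] with x hx
        by_cases hxs : x ∈ s
        · simp only [hx, hxs, Set.indicator_of_mem]
          exact Finset.single_le_sum
            (f := fun j => ‖inner ℂ (fiber (F j) x) (fiber (F i) x)‖ ^ 2)
            (fun j _ => sq_nonneg _) (Finset.mem_univ i)
        · simp [hx, hxs]
      · filter_upwards [hf] with x hx
        by_cases hxs : x ∈ s <;> simp [hx, hxs]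
  filter_upwards [hle] with x hx
  have h2 : ‖inner ℂ (fiber (F i) x) (fiber (F i) x)‖ = ‖fiber (F i) x‖ ^ 2 := by
    rw [inner_self_eq_norm_sq_to_K, norm_pow, RCLike.norm_ofReal, abs_norm]
  rw [h2] at hx
  by_contra! hcon
  nlinarith

end Fiberization

/-! ### Convex functions on the half line -/

section Convex

/-- A function on `[0, ∞)` that is continuous on `(0, ∞)`, made continuous near `0`. -/
def smoothAtZero (φ : ℝ → ℝ) (m : ℕ) (t : ℝ) : ℝ :=
  φ (max t (1 / (m + 1))) + (φ 0 - φ (1 / (m + 1))) * max 0 (1 - (m + 1) * t)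

theorem continuous_smoothAtZero {φ : ℝ → ℝ} (hφ : ContinuousOn φ (Set.Ioi 0)) (m : ℕ) :
    Continuous (smoothAtZero φ m) := by
  unfold smoothAtZero
  refine Continuous.add ?_ (by fun_prop)
  exact hφ.comp_continuous (by fun_prop) fun t => Set.mem_Ioi.2 <|
    lt_of_lt_of_le Nat.one_div_pos_of_nat (le_max_right _ _)

/-- A convex function on [0, ∞) may jump at 0. The continuous approximations are exact at 0 for
every m, and at t > 0 once 1/(m+1) < t. -/
theorem eventually_smoothAtZero_eq (φ : ℝ → ℝ) {t : ℝ} (ht : 0 ≤ t) :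
    ∀ᶠ m : ℕ in Filter.atTop, smoothAtZero φ m t = φ t := by
  rcases ht.eq_or_lt with rfl | ht
  · refine Filter.Eventually.of_forall fun m => ?_
    have : (0 : ℝ) ≤ 1 / (m + 1) := Nat.one_div_pos_of_nat.le
    rw [smoothAtZero, max_eq_right this]
    simp
  · filter_upwards [tendsto_one_div_add_atTop_nhds_zero_nat.eventually (gt_mem_nhds ht)] with m hm
    have h1 : 1 - ((m : ℝ) + 1) * t ≤ 0 := by
      have hpos : (0 : ℝ) < m + 1 := by positivity
      rw [div_lt_iff₀ hpos] at hm
      linarith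
    rw [smoothAtZero, max_eq_left hm.le, max_eq_left h1, mul_zero, add_zero]

/-- The slope is the right derivative, which exists at interior points; at 0 there may be no
supporting line. -/
theorem exists_supporting_line {φ : ℝ → ℝ} (hφ : ConvexOn ℝ (Set.Ici 0) φ) {t₀ : ℝ}
    (h₀ : 0 < t₀) : ∃ m : ℝ, ∀ t, 0 ≤ t → φ t₀ + m * (t - t₀) ≤ φ t := by
  have hint : t₀ ∈ interior (Set.Ici (0 : ℝ)) := by rwa [interior_Ici]
  refine ⟨derivWithin φ (Set.Ioi t₀) t₀, fun t ht => ?_⟩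
  rcases lt_trichotomy t t₀ with h | h | h
  · have h1 := (hφ.slope_le_leftDeriv_of_mem_interior ht hint h).trans
      (hφ.leftDeriv_le_rightDeriv_of_mem_interior hint)
    rw [slope_def_field, div_le_iff₀ (sub_pos.2 h)] at h1
    linarith
  · simp [h]
  · have h1 := hφ.rightDeriv_le_slope_of_mem_interior hint ht h
    rw [slope_def_field, le_div_iff₀ (sub_pos.2 h)] at h1
    linarith

/-- A second contact point would put the value of φ at the midpoint strictly below the line. -/
theorem eq_of_supporting_line_eq {φ : ℝ → ℝ} (hφ : StrictConvexOn ℝ (Set.Ici 0) φ) {t₀ m : ℝ}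
    (h₀ : 0 ≤ t₀) (hm : ∀ t, 0 ≤ t → φ t₀ + m * (t - t₀) ≤ φ t) {t : ℝ} (ht : 0 ≤ t)
    (h : φ t = φ t₀ + m * (t - t₀)) : t = t₀ := by
  by_contra hne
  have h1 := hφ.2 (Set.mem_Ici.2 ht) (Set.mem_Ici.2 h₀) hne (one_half_pos (α := ℝ))
    (one_half_pos (α := ℝ)) (by norm_num)
  have h2 := hm (1 / 2 * t + 1 / 2 * t₀) (by positivity)
  simp only [smul_eq_mul] at h1
  rw [h] at h1
  nlinarith

end Convex

/-! ### The density of the convex potential -/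

section Density

variable {k n : ℕ}

/-- Writes the trace as a series over the fixed basis of ℓ²(ℤᵏ), so that no measurable choice of
bases of J(x) is needed. -/
theorem hasSum_traceOn (K : ClosedSubmodule ℂ (ell2 k)) [FiniteDimensional ℂ K.toSubmodule]
    (A : ell2 k →L[ℂ] ell2 k) :
    HasSum (fun l => (inner ℂ (stdVec l) (A (K.toSubmodule.starProjection (stdVec l)))).re)
      (traceOn K A) := by
  set b := stdOrthonormalBasis ℂ K.toSubmodule with hb
  rw [traceOn_eq_sum b]
  have h := hasSum_sum fun i (_ : i ∈ Finset.univ) =>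
    Complex.hasSum_re (lp.hasSum_inner (b i : ell2 k) (A (b i)))
  refine h.congr_fun fun l => ?_
  rw [b.starProjection_eq_sum_rankOne, ← Complex.re_sum]
  simp only [sum_apply, InnerProductSpace.rankOne_apply, map_sum, map_smul,
    inner_sum, inner_smul_right]
  congr 1
  refine Finset.sum_congr rfl fun i _ => ?_
  rw [← inner_conj_symm, inner_stdVec_left, inner_stdVec_left, RCLike.inner_apply, mul_comm]

theorem aestronglyMeasurable_traceOn {J : Rk k → ClosedSubmodule ℂ (ell2 k)}
    (hJ : IsMeasurableField J)
    (hfin : ∀ᵐ x ∂torusMeasure k, FiniteDimensional ℂ (J x).toSubmodule)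
    {A : Rk k → ell2 k →L[ℂ] ell2 k} (hA : AEStronglyMeasurable A (torusMeasure k)) :
    AEStronglyMeasurable (fun x => traceOn (J x) (A x)) (torusMeasure k) := by
  refine aestronglyMeasurable_of_tendsto_ae (Filter.atTop : Filter (Finset (Fin k → ℤ)))
    (f := fun s x => ∑ l ∈ s,
      (inner ℂ (stdVec l) (A x ((J x).toSubmodule.starProjection (stdVec l)))).re)
    (fun s => ?_) ?_
  · refine Finset.aestronglyMeasurable_fun_sum _ fun l _ => ?_
    have h1 := hJ.aestronglyMeasurable (aestronglyMeasurable_const (b := stdVec l))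
    have h2 : AEStronglyMeasurable (fun x => A x ((J x).toSubmodule.starProjection (stdVec l)))
        (torusMeasure k) :=
      (isBoundedBilinearMap_apply (𝕜 := ℂ) (E := ell2 k)
        (F := ell2 k)).continuous.comp_aestronglyMeasurable (hA.prodMk h1)
    exact Complex.continuous_re.comp_aestronglyMeasurable
      ((aestronglyMeasurable_const (b := stdVec l)).inner (𝕜 := ℂ) h2)
  · filter_upwards [hfin] with x hx
    exact hasSum_traceOn (J x) (A x)

theorem aestronglyMeasurable_pi {α ι E : Type*} [MeasurableSpace α] [Fintype ι]
    [NormedAddCommGroup E] {μ : Measure α} {u : ι → α → E}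
    (hu : ∀ i, AEStronglyMeasurable (u i) μ) : AEStronglyMeasurable (fun x i => u i x) μ := by
  classical
  have h : (fun x i => u i x) = fun x => ∑ i, Pi.single (M := fun _ => E) i (u i x) := by
    funext x
    exact (Finset.univ_sum_single fun i => u i x).symm
  rw [h]
  exact Finset.aestronglyMeasurable_fun_sum _ fun i _ =>
    (continuous_single i).comp_aestronglyMeasurable (hu i)

theorem aestronglyMeasurable_potentialDensity {W : ClosedSubmodule ℂ (L2 k)} (hW : IsFSI W)
    {F : Fin n → L2 k} (hFW : ∀ i, F i ∈ W) {φ : ℝ → ℝ} (hφ : ContinuousOn φ (Set.Ioi 0)) :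
    AEStronglyMeasurable (potentialDensity φ W F) (torusMeasure k) := by
  have hJ := isRangeFunction_rangeFunction hW
  have hcont : ∀ ψ : ℝ → ℝ, Continuous ψ →
      AEStronglyMeasurable (potentialDensity ψ W F) (torusMeasure k) := fun ψ hψ => by
    refine aestronglyMeasurable_traceOn hJ.measurable
      ((ae_finiteDimensional_rangeFunction hW).mono fun x hx => hx.1) ?_
    exact (continuous_cfc_frameOperator (H := ell2 k) n hψ).comp_aestronglyMeasurable
      (aestronglyMeasurable_pi fun i => aestronglyMeasurable_fiber (F i))
  -- The density depends on φ only through finitely many eigenvalues cᵢ ≥ 0, so the densities of the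
  -- approximations converge at almost every x.
  refine aestronglyMeasurable_of_tendsto_ae Filter.atTop
    (fun m => hcont _ (continuous_smoothAtZero hφ m)) ?_
  filter_upwards [ae_finiteDimensional_rangeFunction hW,
    ae_all_iff.2 fun i => (hJ.mem_iff (F i)).1 (hFW i)] with x hx hFx
  have := hx.1
  obtain ⟨b, c, hc0, -, -, hpot, -⟩ :=
    exists_eigenbasis_frameOperator (fun i => fiber (F i) x) (rangeFunction W x) hFx
  simp only [potentialDensity, hpot]
  refine tendsto_finsetSum _ fun i _ => tendsto_const_nhds.congr' ?_
  filter_upwards [eventually_smoothAtZero_eq φ (hc0 i)] with m hm using hm.symm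

/-- Spectral description of the density of the convex potential. -/
theorem ae_exists_eigenbasis {W : ClosedSubmodule ℂ (L2 k)} (hW : IsFSI W)
    {F : Fin n → L2 k} (hFW : ∀ i, F i ∈ W) :
    ∀ᵐ x ∂torusMeasure k, fiberDim W x ≤ length W ∧ (∀ i, fiber (F i) x ∈ rangeFunction W x) ∧
      ∃ (b : OrthonormalBasis (Fin (fiberDim W x)) ℂ (rangeFunction W x).toSubmodule)
        (c : Fin (fiberDim W x) → ℝ), (∀ i, 0 ≤ c i) ∧
        (∀ i, fiberFrameOperator F x (b i) = (c i : ℂ) • (b i : ell2 k)) ∧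
        (∀ φ : ℝ → ℝ, potentialDensity φ W F x = ∑ i, φ (c i)) ∧
        ∑ i, c i = ∑ i, ‖fiber (F i) x‖ ^ 2 := by
  have hJ := isRangeFunction_rangeFunction hW
  filter_upwards [ae_finiteDimensional_rangeFunction hW,
    ae_all_iff.2 fun i => (hJ.mem_iff (F i)).1 (hFW i)] with x hx hFx
  have := hx.1
  obtain ⟨b, c, hc0, hb, -, hpot, hsum⟩ :=
    exists_eigenbasis_frameOperator (fun i => fiber (F i) x) (rangeFunction W x) hFx
  exact ⟨hx.2, hFx, b, c, hc0, hb, hpot, hsum⟩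

theorem integrable_potentialDensity {W : ClosedSubmodule ℂ (L2 k)} (hW : IsFSI W)
    {F : Fin n → L2 k} (hFW : ∀ i, F i ∈ W) (hE : IsBessel (translates F)) {φ : ℝ → ℝ}
    (hφ : IsConv φ) : Integrable (potentialDensity φ W F) (torusMeasure k) := by
  have hcont : ContinuousOn φ (Set.Ioi 0) := by
    have := hφ.1.continuousOn_interior
    rwa [interior_Ici] at this
  obtain ⟨B, hB0, hB⟩ := exists_ae_norm_sq_fiber_le hE
  refine Integrable.of_bound (aestronglyMeasurable_potentialDensity hW hFW hcont)
    -- There are at most `length W` eigenvalues. Each is at most their sum, so lies in [0, nB],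
    -- where a convex function is bounded by its larger endpoint value.
    (length W * max (φ 0) (φ (n * B))) ?_
  filter_upwards [ae_exists_eigenbasis hW hFW, hB] with x hx hBx
  obtain ⟨hd, -, b, c, hc0, -, hpot, hsum⟩ := hx
  have hmax : 0 ≤ max (φ 0) (φ (n * B)) := (hφ.2 0 le_rfl).trans (le_max_left _ _)
  have hcB : ∀ i, c i ≤ n * B := fun i =>
    calc c i ≤ ∑ i, c i := Finset.single_le_sum (fun j _ => hc0 j) (Finset.mem_univ i)
      _ = ∑ i, ‖fiber (F i) x‖ ^ 2 := hsum
      _ ≤ ∑ _i : Fin n, B := Finset.sum_le_sum fun i _ => hBx i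
      _ = n * B := by simp
  rw [hpot, Real.norm_of_nonneg (Finset.sum_nonneg fun i _ => hφ.2 _ (hc0 i))]
  calc ∑ i, φ (c i) ≤ ∑ _i : Fin (fiberDim W x), max (φ 0) (φ (n * B)) :=
        Finset.sum_le_sum fun i _ => hφ.1.le_max_of_mem_Icc (Set.mem_Ici.2 le_rfl)
          (Set.mem_Ici.2 (by positivity)) ⟨hc0 i, hcB i⟩
    _ = fiberDim W x * max (φ 0) (φ (n * B)) := by simp
    _ ≤ length W * max (φ 0) (φ (n * B)) := by gcongr

/-- The dimension is the potential density of the empty family for φ = 1. -/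
theorem aemeasurable_fiberDim {W : ClosedSubmodule ℂ (L2 k)} (hW : IsFSI W) :
    AEMeasurable (fun x => (fiberDim W x : ℝ)) (torusMeasure k) := by
  have h := aestronglyMeasurable_potentialDensity hW (n := 0) (F := Fin.elim0)
    (fun i => i.elim0) (φ := fun _ => 1) continuousOn_const
  refine h.aemeasurable.congr ?_
  filter_upwards [ae_exists_eigenbasis hW (n := 0) (F := Fin.elim0) (fun i => i.elim0)] with x hx
  obtain ⟨-, -, b, c, -, -, hpot, -⟩ := hx
  rw [hpot]
  simp

theorem integrable_fiberDim {W : ClosedSubmodule ℂ (L2 k)} (hW : IsFSI W) :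
    Integrable (fun x => (fiberDim W x : ℝ)) (torusMeasure k) := by
  refine Integrable.of_bound (aemeasurable_fiberDim hW).aestronglyMeasurable (length W) ?_
  filter_upwards [ae_finiteDimensional_rangeFunction hW] with x hx
  rw [Real.norm_natCast]
  exact_mod_cast hx.2

/-- Points of dimension 0, absent from the sum, contribute nothing, and dimensions above `length W`
occur only on a null set. -/
theorem kappa_eq_integral {W : ClosedSubmodule ℂ (L2 k)} (hW : IsFSI W) :
    kappa W = ∫ x in torus k, (fiberDim W x : ℝ) := by
  have hnull : ∀ i : ℕ, NullMeasurableSet {x | fiberDim W x = i} (torusMeasure k) := fun i => by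
    have := (aemeasurable_fiberDim hW).nullMeasurableSet_preimage (measurableSet_singleton (i : ℝ))
    convert this using 1
    ext x
    simp
  have hae : (fun x => (fiberDim W x : ℝ)) =ᵐ[torusMeasure k]
      fun x => ∑ i ∈ Finset.Icc 1 (length W), {x | fiberDim W x = i}.indicator
        (fun _ => (i : ℝ)) x := by
    filter_upwards [ae_finiteDimensional_rangeFunction hW] with x hx
    simp only [Set.indicator_apply, Set.mem_ofPred_eq]
    rw [Finset.sum_ite_eq]
    split_ifs with h
    · rfl
    · have : fiberDim W x = 0 := by
        by_contra h0
        exact h (Finset.mem_Icc.2 ⟨Nat.one_le_iff_ne_zero.2 h0, hx.2⟩)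
      simp [this]
  rw [integral_congr_ae hae, integral_finsetSum _ fun i _ =>
    (integrable_const _).indicator₀ (hnull i), kappa]
  refine Finset.sum_congr rfl fun i _ => ?_
  rw [integral_indicator₀ (hnull i), setIntegral_const, smul_eq_mul, mul_comm]
  congr 1
  rw [measureReal_def, measureReal_def, Measure.restrict_apply' (measurableSet_torus k)]
  congr 2
  ext x
  exact and_comm

theorem integral_sum_norm_sq_fiber (F : Fin n → L2 k) :
    Integrable (fun x => ∑ i, ‖fiber (F i) x‖ ^ 2) (torusMeasure k) ∧
      ∫ x in torus k, ∑ i, ‖fiber (F i) x‖ ^ 2 = ∑ i, ‖F i‖ ^ 2 := by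
  refine ⟨integrable_finsetSum _ fun i _ => integrable_norm_sq_fiber (F i), ?_⟩
  rw [integral_finsetSum _ fun i _ => integrable_norm_sq_fiber (F i)]
  exact Finset.sum_congr rfl fun i _ => (norm_sq_eq_integral_fiber _).symm

end Density

/-! ### Optimality of tight frames for convex potentials -/

section Optimality

variable {k n : ℕ} {W : ClosedSubmodule ℂ (L2 k)} {F : Fin n → L2 k}

/-- If κ = 0, almost all fibers lie in the zero space, which contradicts the normalization. -/
theorem kappa_pos (hW : IsFSI W) (hFW : ∀ i, F i ∈ W) (hF : ∑ i, ‖F i‖ ^ 2 = 1) :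
    0 < kappa W := by
  rw [kappa_eq_integral hW]
  refine lt_of_le_of_ne (integral_nonneg fun x => Nat.cast_nonneg _) fun h => ?_
  have h0 := (integral_eq_zero_iff_of_nonneg (fun x => Nat.cast_nonneg (fiberDim W x))
    (integrable_fiberDim hW)).1 h.symm
  have h1 : ∫ x in torus k, ∑ i, ‖fiber (F i) x‖ ^ 2 = 0 := by
    rw [integral_congr_ae (g := fun _ => (0 : ℝ)), integral_zero]
    filter_upwards [h0, ae_exists_eigenbasis hW hFW] with x hx hb
    obtain ⟨-, -, b, c, -, -, -, hsum⟩ := hb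
    have hd : fiberDim W x = 0 := by simpa using hx
    have : IsEmpty (Fin (fiberDim W x)) := by rw [hd]; infer_instance
    rw [← hsum, Finset.univ_eq_empty, Finset.sum_empty]
  rw [(integral_sum_norm_sq_fiber F).2, hF] at h1
  exact one_ne_zero h1

/-- The affine lower bound for the density of the potential given by a supporting line of slope
`m` at `t`. -/
def affineDensity (φ : ℝ → ℝ) (m t : ℝ) (W : ClosedSubmodule ℂ (L2 k)) (F : Fin n → L2 k)
    (x : Rk k) : ℝ :=
  (φ t - m * t) * fiberDim W x + m * ∑ i, ‖fiber (F i) x‖ ^ 2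

/-- The slope contributes −m·κ⁻¹·κ + m·1 = 0; this is why κ⁻¹ is the right contact point. -/
theorem integral_affineDensity (hW : IsFSI W) (hF : ∑ i, ‖F i‖ ^ 2 = 1) (hκ : 0 < kappa W)
    (φ : ℝ → ℝ) (m : ℝ) :
    Integrable (affineDensity φ m (kappa W)⁻¹ W F) (torusMeasure k) ∧
      ∫ x in torus k, affineDensity φ m (kappa W)⁻¹ W F x = kappa W * φ (kappa W)⁻¹ := by
  have h1 := (integrable_fiberDim hW).const_mul (φ (kappa W)⁻¹ - m * (kappa W)⁻¹)
  have h2 := (integral_sum_norm_sq_fiber F).1.const_mul m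
  refine ⟨h1.add h2, ?_⟩
  unfold affineDensity
  rw [integral_add h1 h2, integral_const_mul, integral_const_mul,
    (integral_sum_norm_sq_fiber F).2, hF, ← kappa_eq_integral hW]
  field_simp
  ring

theorem ae_affineDensity_le (hW : IsFSI W) (hFW : ∀ i, F i ∈ W) {φ : ℝ → ℝ} {m t₀ : ℝ}
    (hm : ∀ t, 0 ≤ t → φ t₀ + m * (t - t₀) ≤ φ t) :
    ∀ᵐ x ∂torusMeasure k, affineDensity φ m t₀ W F x ≤ potentialDensity φ W F x := by
  filter_upwards [ae_exists_eigenbasis hW hFW] with x hx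
  obtain ⟨-, -, b, c, hc0, -, hpot, hsum⟩ := hx
  rw [hpot, affineDensity, ← hsum]
  calc (φ t₀ - m * t₀) * fiberDim W x + m * ∑ i, c i
      = ∑ i, (φ t₀ + m * (c i - t₀)) := by
        rw [Finset.sum_add_distrib, ← Finset.mul_sum, Finset.sum_sub_distrib]
        simp only [Finset.sum_const, Finset.card_univ, Fintype.card_fin, nsmul_eq_mul]
        ring
    _ ≤ ∑ i, φ (c i) := Finset.sum_le_sum fun i _ => hm _ (hc0 i)

theorem kappa_mul_le_potential (hW : IsFSI W) (hFW : ∀ i, F i ∈ W)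
    (hE : IsBessel (translates F)) (hF : ∑ i, ‖F i‖ ^ 2 = 1) {φ : ℝ → ℝ} (hφ : IsConv φ) :
    kappa W * φ (kappa W)⁻¹ ≤ potential φ W F := by
  have hκ := kappa_pos hW hFW hF
  obtain ⟨m, hm⟩ := exists_supporting_line hφ.1 (inv_pos.2 hκ)
  rw [← (integral_affineDensity hW hF hκ φ m).2, potential]
  exact integral_mono_ae (integral_affineDensity hW hF hκ φ m).1
    (integrable_potentialDensity hW hFW hE hφ) (ae_affineDensity_le hW hFW hm)

/-- Equal integrals of ordered densities give equality almost everywhere, then in each term of the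
eigenvalue sum, and strict convexity makes every eigenvalue κ⁻¹. -/
theorem ae_fiberFrameOperator_eq_of_potential_eq (hW : IsFSI W) (hFW : ∀ i, F i ∈ W)
    (hE : IsBessel (translates F)) (hF : ∑ i, ‖F i‖ ^ 2 = 1) {φ : ℝ → ℝ} (hφ : IsStrictConv φ)
    (h : potential φ W F = kappa W * φ (kappa W)⁻¹) :
    ∀ᵐ x ∂torusMeasure k, fiberFrameOperator F x =
      (((kappa W)⁻¹ : ℝ) : ℂ) • (rangeFunction W x).toSubmodule.starProjection := by
  have hκ := kappa_pos hW hFW hF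
  have hφ' : IsConv φ := ⟨hφ.1.convexOn, hφ.2⟩
  set t₀ := (kappa W)⁻¹ with ht₀
  have ht₀pos : 0 < t₀ := inv_pos.2 hκ
  obtain ⟨m, hm⟩ := exists_supporting_line hφ'.1 ht₀pos
  have hA := integral_affineDensity hW hF hκ φ m
  have heq : affineDensity φ m t₀ W F =ᵐ[torusMeasure k] potentialDensity φ W F :=
    (integral_eq_iff_of_ae_le hA.1 (integrable_potentialDensity hW hFW hE hφ')
      (ae_affineDensity_le hW hFW hm)).1 (hA.2.trans h.symm)
  filter_upwards [heq, ae_exists_eigenbasis hW hFW] with x hx hb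
  obtain ⟨-, hFx, b, c, hc0, hbc, hpot, hsum⟩ := hb
  have h1 : ∑ i, (φ t₀ + m * (c i - t₀)) = ∑ i, φ (c i) := by
    rw [← hpot, ← hx, affineDensity, ← hsum, Finset.sum_add_distrib, ← Finset.mul_sum,
      Finset.sum_sub_distrib]
    simp only [Finset.sum_const, Finset.card_univ, Fintype.card_fin, nsmul_eq_mul]
    ring
  have h2 := (Finset.sum_eq_sum_iff_of_le fun i _ => hm _ (hc0 i)).1 h1
  refine frameOperator_eq_smul_starProjection _ hFx b fun i => ?_
  rw [hbc, eq_of_supporting_line_eq hφ.1 ht₀pos.le hm (hc0 i) (h2 i (Finset.mem_univ i)).symm]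

theorem ae_eigenvalues_eq (hW : IsFSI W) (hFW : ∀ i, F i ∈ W) {a : ℝ}
    (h : ∀ᵐ x ∂torusMeasure k, fiberFrameOperator F x =
      (a : ℂ) • (rangeFunction W x).toSubmodule.starProjection) :
    ∀ᵐ x ∂torusMeasure k, (∀ φ : ℝ → ℝ, potentialDensity φ W F x = fiberDim W x * φ a) ∧
      ∑ i, ‖fiber (F i) x‖ ^ 2 = fiberDim W x * a := by
  filter_upwards [h, ae_exists_eigenbasis hW hFW] with x hx hb
  obtain ⟨-, -, b, c, -, hbc, hpot, hsum⟩ := hb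
  have hca : ∀ i, c i = a := fun i => by
    have h1 := hbc i
    rw [hx, smul_apply, Submodule.starProjection_eq_self_iff.2 (b i).2] at h1
    have hne : (b i : ell2 k) ≠ 0 := by
      simpa using b.orthonormal.ne_zero i
    exact_mod_cast (smul_left_injective ℂ hne h1).symm
  refine ⟨fun φ => ?_, ?_⟩
  · rw [hpot]
    simp [hca]
  · rw [← hsum]
    simp [hca]

theorem potential_eq_iff (hW : IsFSI W) (hFW : ∀ i, F i ∈ W)
    (hE : IsBessel (translates F)) (hF : ∑ i, ‖F i‖ ^ 2 = 1) {φ : ℝ → ℝ} (hφ : IsStrictConv φ) :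
    potential φ W F = kappa W * φ (kappa W)⁻¹ ↔
      frameOperator (translates F) hE =
        (((kappa W)⁻¹ : ℝ) : ℂ) • W.toSubmodule.starProjection := by
  rw [frameOperator_translates_eq_iff_ae hE (isRangeFunction_rangeFunction hW)]
  refine ⟨ae_fiberFrameOperator_eq_of_potential_eq hW hFW hE hF hφ, fun h => ?_⟩
  rw [potential, kappa_eq_integral hW, ← integral_mul_const, ← kappa_eq_integral hW]
  refine integral_congr_ae ?_
  filter_upwards [ae_eigenvalues_eq hW hFW h] with x hx using hx.1 φ

theorem translates_mem (hW : IsFSI W) (hFW : ∀ i, F i ∈ W) (p : (Fin k → ℤ) × Fin n) :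
    translates F p ∈ W := by
  have hJ := isRangeFunction_rangeFunction hW
  refine (hJ.mem_iff _).2 ?_
  filter_upwards [(hJ.mem_iff _).1 (hFW p.2), fiber_translation p.1 (F p.2)] with x h1 h2
  rw [translates, h2]
  exact (rangeFunction W x).toSubmodule.smul_mem _ h1

theorem isTightFrame_iff (hW : IsFSI W) (hFW : ∀ i, F i ∈ W)
    (hE : IsBessel (translates F)) (hF : ∑ i, ‖F i‖ ^ 2 = 1) :
    IsTightFrame W (translates F) ↔
      frameOperator (translates F) hE =
        (((kappa W)⁻¹ : ℝ) : ℂ) • W.toSubmodule.starProjection := by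
  have hκ := kappa_pos hW hFW hF
  constructor
  · rintro ⟨a, -, -, -, ha⟩
    have h1 : frameOperator (translates F) hE =
        (a : ℂ) • W.toSubmodule.starProjection := by
      -- The tight frame identity is given only on W; as the translates lie in W, the coefficients
      -- of f are those of its projection.
      refine (frameOperator_translates_eq_iff_tsum hE W a).2 fun f => ?_
      obtain ⟨-, h2, h3⟩ := ha _ (W.toSubmodule.starProjection_apply_mem f)
      rw [le_antisymm h2 h3]
      refine tsum_congr fun p => ?_
      rw [← Submodule.inner_starProjection_left_eq_right,
        Submodule.starProjection_eq_self_iff.2 (translates_mem hW hFW p)]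
    have h2 := (frameOperator_translates_eq_iff_ae hE (isRangeFunction_rangeFunction hW) a).1 h1
    -- Integrating the traces of the fiber operators determines the frame bound.
    have h3 : ∑ i, ‖F i‖ ^ 2 = kappa W * a := by
      rw [← (integral_sum_norm_sq_fiber F).2, kappa_eq_integral hW, ← integral_mul_const]
      refine integral_congr_ae ?_
      filter_upwards [ae_eigenvalues_eq hW hFW h2] with x hx using hx.2
    rw [h1, eq_inv_of_mul_eq_one_right (h3.symm.trans hF)]
  · intro h
    have h1 := (frameOperator_translates_eq_iff_tsum hE W _).1 h
    refine ⟨(kappa W)⁻¹, inv_pos.2 hκ, le_rfl, translates_mem hW hFW, fun f hf => ?_⟩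
    have h2 := h1 f
    rw [Submodule.starProjection_eq_self_iff.2 hf] at h2
    obtain ⟨b, -, hb⟩ := id hE
    exact ⟨(hb f).1, h2.ge, h2.le⟩

end Optimality

end

end FSI

theorem mainTheorem3 (k n : ℕ) (W : ClosedSubmodule ℂ (FSI.L2 k)) (hW : FSI.IsFSI W)
    (F : Fin n → FSI.L2 k) (hFW : ∀ i, F i ∈ W) (hE : FSI.IsBessel (FSI.translates F))
    (hF : ∑ i, ‖F i‖ ^ 2 = 1) :
    0 < FSI.kappa W ∧
    (∀ φ : ℝ → ℝ, FSI.IsConv φ →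
      MeasureTheory.IntegrableOn (FSI.potentialDensity φ W F) (FSI.torus k) ∧
      FSI.kappa W * φ (FSI.kappa W)⁻¹ ≤ FSI.potential φ W F) ∧
    (∀ φ : ℝ → ℝ, FSI.IsStrictConv φ →
      (FSI.potential φ W F = FSI.kappa W * φ (FSI.kappa W)⁻¹ ↔
        FSI.frameOperator (FSI.translates F) hE =
          ((FSI.kappa W)⁻¹ : ℂ) • W.toSubmodule.starProjection)) ∧
    (FSI.IsTightFrame W (FSI.translates F) ↔
      FSI.frameOperator (FSI.translates F) hE =
        ((FSI.kappa W)⁻¹ : ℂ) • W.toSubmodule.starProjection) := by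
  rw [← Complex.ofReal_inv]
  exact ⟨FSI.kappa_pos hW hFW hF,
    fun φ hφ => ⟨FSI.integrable_potentialDensity hW hFW hE hφ,
      FSI.kappa_mul_le_potential hW hFW hE hF hφ⟩,
    fun φ hφ => FSI.potential_eq_iff hW hFW hE hF hφ,
    FSI.isTightFrame_iff hW hFW hE hF⟩
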